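/- Let $n \ge 4$. For a Riemannian metric $g$ on an $n$-manifold let $R$ be its curvature tensor and let $W$ be its Weyl tensor, the totally trace-free part of $R$. A Riemannian manifold is curvature homogeneous if for any points $x,y$ there is a linear isometry $T_x \to T_y$ mapping $R_x$ to $R_y$; it is modeled on a homogeneous space $M_0$ if for every $x$ there is a linear isometry $T_x \to T_oM_0$ ($o\in M_0$ fixed) mapping the curvature tensor at $x$ to that of $M_0$ at $o$. Weyl homogeneous, and Weyl homogeneous modeled on $M_0$, are defined in the same way with the Weyl tensor in place of the curvature tensor and "mapped to a positive multiple of" in place of "mapped to". For $\kappa \ne 0$ let $M^2(\kappa)$ be the two-dimensional space of constant curvature $\kappa$, with the metric $(dy_0^2+dy_1^2)/(1+\frac{\kappa}{4}(y_0^2+y_1^2))^2$ in the stereographic chart. (1) Let $I \subset \mathbb{R}$ be an open interval containing $0$, let $D_{ij}(w)$, $i,j=1,\dots,n-1$, be a skew-symmetric matrix of smooth functions on $I$, let $a(w), b(w)$ be smooth functions without zeros on $I$, and let $\lambda>0$, $\varepsilon=\pm 1$, $\kappa=-\varepsilon\lambda^2$. Put $$f_{+}(x,w)= a(w) e^{\lambda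 x}+b(w) e^{-\lambda x}, \qquad f_{-}(x,w)= a(w) \cos(\lambda x)+b(w) \sin(\lambda x).$$ On the open set $M$ of all $(w,x_1,\dots,x_{n-1}) \in I \times \mathbb{R}^{n-1}$ with $f_\varepsilon(x_1,w) \neq 0$, $$ds^2=(f_{\varepsilon}(x_1,w)\, dw)^2 + \sum_{i=1}^{n-1} \Big(dx_i +\sum_{j=1}^{n-1} D_{ij}(w) x_j\, dw\Big)^2$$ is a smooth Riemannian metric. It is curvature homogeneous and modeled on $M^2(\kappa)\times\mathbb{R}^{n-2}$, and it is Weyl homogeneous and modeled, as such, on the same space. Moreover, let $w_0 \in I$ be such that $D_{1i}(w_0)\ne 0$ for some $i>1$. Then $M$ contains points with $w=w_0$, and no neighbourhood of such a point is conformally equivalent to an open subset of a locally symmetric Riemannian manifold (in particular, of a symmetric space), nor to an open subset of the model space $M^2(\kappa)\times\mathbb{R}^{n-2}$. (2) Consequently, for all $n \ge 4$ and $\kappa\ne 0$ there is a connected Weyl homogeneous Riemannian manifold of dimension $n$ that is modeled on the reducible symmetric space $M^2(\kappa)\times\mathbb{R}^{n-2}$, but at none of its points is it locally conformally equivalent to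 $M^2(\kappa)\times\mathbb{R}^{n-2}$ or to any locally symmetric Riemannian manifold. -/

import Mathlib

open Set Filter Topology
open scoped Manifold ContDiff

universe u

noncomputable section

namespace WeylHom

/-- The coordinate space `ℝⁿ`. -/
abbrev Coord (n : ℕ) : Type := EuclideanSpace ℝ (Fin n)

/-- A field of bilinear forms on `ℝⁿ`, a (candidate) metric tensor in coordinates. -/
abbrev FormField (n : ℕ) : Type := Coord n → Coord n →L[ℝ] Coord n →L[ℝ] ℝ

/-- The `i`-th coordinate differential `dyᵢ`. -/
def dcoord {n : ℕ} (i : Fin n) : Coord n →L[ℝ] ℝ := EuclideanSpace.proj i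

/-- The square `θ² = θ ⊗ θ` of a covector. -/
def sq {n : ℕ} (θ : Coord n →L[ℝ] ℝ) : Coord n →L[ℝ] Coord n →L[ℝ] ℝ := θ.smulRight θ

/-- `g` is a smooth Riemannian metric on the open set `U ⊆ ℝⁿ`. -/
structure IsRiemannianMetricOn {n : ℕ} (U : Set (Coord n)) (g : FormField n) : Prop where
  isOpen : IsOpen U
  smooth : ContDiffOn ℝ ∞ g U
  symm : ∀ x ∈ U, ∀ u v, g x u v = g x v u
  pos : ∀ x ∈ U, ∀ u, u ≠ 0 → 0 < g x u u

section Curvature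

variable {n : ℕ} (g : FormField n)

/-- Raising an index: `sharp g x α` is the vector `u` with `g x u = α` (for `g x` nondegenerate). -/
def sharp (x : Coord n) : (Coord n →L[ℝ] ℝ) →L[ℝ] Coord n := (g x).inverse

/-- Christoffel symbols of the first kind:
`w ↦ ½ ((∂_u g)(v, w) + (∂_v g)(u, w) - (∂_w g)(u, v))`. -/
def christoffelFirst (x u v : Coord n) : Coord n →L[ℝ] ℝ :=
  (1 / 2 : ℝ) • (fderiv ℝ g x u v + fderiv ℝ g x v u - ((fderiv ℝ g x).flip u).flip v)

/-- Christoffel symbols of the Levi-Civita connection: `∇_u v = ∂_u v + Γ(u, v)`. -/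
def christoffel (x u v : Coord n) : Coord n := sharp g x (christoffelFirst g x u v)

/-- The curvature operator `R(u, v) w = ∇_u ∇_v w - ∇_v ∇_u w - ∇_[u,v] w`. -/
def curvatureOp (x u v w : Coord n) : Coord n :=
  fderiv ℝ (fun y => christoffel g y v w) x u - fderiv ℝ (fun y => christoffel g y u w) x v
    + christoffel g x u (christoffel g x v w) - christoffel g x v (christoffel g x u w)

/-- The curvature tensor `R(u, v, w, z) = ⟨R(u, v) w, z⟩`. -/
def riemann (x u v w z : Coord n) : ℝ := g x (curvatureOp g x u v w) z

/-- The Ricci form `Ric(v, w) = tr (u ↦ R(u, v) w)`. -/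
def ricci (x v w : Coord n) : ℝ :=
  ∑ i : Fin n, dcoord i (curvatureOp g x (EuclideanSpace.single i 1) v w)

/-- The scalar curvature, `∑ gⁱʲ Ric_ij`. -/
def scal (x : Coord n) : ℝ :=
  ∑ i : Fin n, ricci g x (EuclideanSpace.single i 1) (sharp g x (dcoord i))

/-- The form `⟨ρ u, v⟩`, where `ρ = Ric / (n - 2) - scal / (2 (n - 1) (n - 2)) id`. -/
def schouten (x u v : Coord n) : ℝ :=
  ricci g x u v / ((n : ℝ) - 2) - scal g x / (2 * ((n : ℝ) - 1) * ((n : ℝ) - 2)) * g x u v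

/-- The Weyl conformal curvature tensor (the totally trace-free part of the curvature tensor). -/
def weyl (x u v w z : Coord n) : ℝ :=
  riemann g x u v w z
    - (schouten g x v w * g x u z + schouten g x u z * g x v w
      - schouten g x u w * g x v z - schouten g x v z * g x u w)

end Curvature

/-- There is a linear isometry `ι : T_x → T_y` (for `g` at `x` and `h` at `y`) which maps the
curvature tensor of `g` at `x` to the curvature tensor of `h` at `y`. -/
def SameCurvature {n : ℕ} (g : FormField n) (x : Coord n) (h : FormField n) (y : Coord n) : Prop :=
  ∃ ι : Coord n ≃ₗ[ℝ] Coord n,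
    (∀ u v, h y (ι u) (ι v) = g x u v) ∧
    ∀ u v w z, riemann g x u v w z = riemann h y (ι u) (ι v) (ι w) (ι z)

/-- There is a linear isometry `ι : T_x → T_y` (for `g` at `x` and `h` at `y`) which maps the
Weyl tensor of `g` at `x` to a positive multiple of the Weyl tensor of `h` at `y`. -/
def SameWeyl {n : ℕ} (g : FormField n) (x : Coord n) (h : FormField n) (y : Coord n) : Prop :=
  ∃ ι : Coord n ≃ₗ[ℝ] Coord n, ∃ c : ℝ, 0 < c ∧
    (∀ u v, h y (ι u) (ι v) = g x u v) ∧
    ∀ u v w z, weyl g x u v w z = c * weyl h y (ι u) (ι v) (ι w) (ι z)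

/-- `(U, g)` is curvature homogeneous. -/
def CurvatureHomogeneous {n : ℕ} (U : Set (Coord n)) (g : FormField n) : Prop :=
  ∀ x ∈ U, ∀ y ∈ U, SameCurvature g x g y

/-- `(U, g)` is Weyl homogeneous. -/
def WeylHomogeneous {n : ℕ} (U : Set (Coord n)) (g : FormField n) : Prop :=
  ∀ x ∈ U, ∀ y ∈ U, SameWeyl g x g y

/-- `(U, g)` has at each point the curvature tensor of the homogeneous space with metric `h` at its
point `o`. -/
def CurvatureModeledOn {n : ℕ} (U : Set (Coord n)) (g h : FormField n) (o : Coord n) : Prop :=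
  ∀ x ∈ U, SameCurvature g x h o

/-- `(U, g)` has at each point, up to a positive multiple, the Weyl tensor of the homogeneous space
with metric `h` at its point `o`. -/
def WeylModeledOn {n : ℕ} (U : Set (Coord n)) (g h : FormField n) (o : Coord n) : Prop :=
  ∀ x ∈ U, SameWeyl g x h o

/-- The conformal denominator `1 + (κ / 4) (y₀² + y₁²)` of the constant curvature metric. -/
def modelDenom {m : ℕ} (κ : ℝ) (y : Coord (m + 1)) : ℝ := 1 + κ / 4 * (y 0 ^ 2 + y 1 ^ 2)

/-- The domain of the stereographic chart of `M²(κ) × ℝⁿ⁻²`, `n = m + 1`: the whole space for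
`κ ≤ 0` (for `κ < 0`, the Poincaré disc times `ℝⁿ⁻²`), and all of it but the line over one point
of the sphere for `κ > 0`. -/
def modelDomain (m : ℕ) (κ : ℝ) : Set (Coord (m + 1)) := {y | 0 < modelDenom κ y}

/-- The metric of `M²(κ) × ℝⁿ⁻²`, `n = m + 1`, in the stereographic chart:
`(dy₀² + dy₁²) / (1 + (κ / 4) (y₀² + y₁²))² + dy₂² + ⋯ + dy_m²`. -/
def modelMetric (m : ℕ) (κ : ℝ) : FormField (m + 1) := fun y =>
  ∑ i : Fin (m + 1),
    (if i = 0 ∨ i = 1 then (modelDenom κ y ^ 2)⁻¹ else 1) • sq (dcoord i)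

/-- The function `f_ε(x, w)`: `a(w) e^{lx} + b(w) e^{-lx}` for `ε = 1`, and
`a(w) cos (lx) + b(w) sin (lx)` for `ε = -1`. -/
def warp (ε : ℤˣ) (l : ℝ) (a b : ℝ → ℝ) (x w : ℝ) : ℝ :=
  if ε = 1 then a w * Real.exp (l * x) + b w * Real.exp (-(l * x))
  else a w * Real.cos (l * x) + b w * Real.sin (l * x)

/-- The manifold `Mⁿ`, `n = m + 1`. Points are `p = (w, x₁, …, x_m)`, with `w = p 0` and
`x₁, …, x_m` the coordinates `p i.succ`, `i : Fin m`. It consists of all points with `w ∈ I` at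
which the form `ds²` is nondegenerate. -/
def exDomain {m : ℕ} [NeZero m] (I : Set ℝ) (ε : ℤˣ) (l : ℝ) (a b : ℝ → ℝ) :
    Set (Coord (m + 1)) :=
  {p | p 0 ∈ I ∧ warp ε l a b (p (Fin.succ 0)) (p 0) ≠ 0}

/-- The metric `ds² = (f_ε(x₁, w) dw)² + ∑ᵢ (dxᵢ + ∑ⱼ D_ij(w) xⱼ dw)²`. -/
def exMetric {m : ℕ} [NeZero m] (ε : ℤˣ) (l : ℝ) (a b : ℝ → ℝ)
    (D : ℝ → Matrix (Fin m) (Fin m) ℝ) : FormField (m + 1) := fun p =>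
  sq (warp ε l a b (p (Fin.succ 0)) (p 0) • dcoord 0)
    + ∑ i : Fin m, sq (dcoord i.succ + (∑ j : Fin m, D (p 0) i j * p j.succ) • dcoord 0)

section Symmetric

variable {n : ℕ} {N : Type*} [TopologicalSpace N] [ChartedSpace (Coord n) N]

/-- A field of bilinear forms on the tangent spaces of a manifold. -/
abbrev TangentForms (n : ℕ) (N : Type*) [TopologicalSpace N] [ChartedSpace (Coord n) N] :=
  ∀ q : N, TangentSpace (𝓡 n) q →L[ℝ] TangentSpace (𝓡 n) q →L[ℝ] ℝ

/-- `φ` restricts to a smooth conformal map from `(V, g)`, `V ⊆ ℝⁿ`, to the `n`-manifold `(N, h)`,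
that is, `φ^* h = e^{2σ} g` on `V` for a smooth function `σ`. -/
def IsConformalMapOn (V : Set (Coord n)) (g : FormField n) (h : TangentForms n N)
    (φ : Coord n → N) : Prop :=
  ContMDiffOn (𝓡 n) (𝓡 n) ∞ φ V ∧ ∃ σ : Coord n → ℝ, ContDiffOn ℝ ∞ σ V ∧
    ∀ x ∈ V, ∀ u v : Coord n,
      h (φ x) (mfderiv (𝓡 n) (𝓡 n) φ x u) (mfderiv (𝓡 n) (𝓡 n) φ x v)
        = Real.exp (2 * σ x) * g x u v

/-- Some neighbourhood of `p` is mapped conformally to the part `S` of `(N, h)`. The negation says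
that no neighbourhood of `p` is conformally equivalent to an open subset of `(S, h)`. -/
def LocallyConformalAt (p : Coord n) (g : FormField n) (S : Set N) (h : TangentForms n N) : Prop :=
  ∃ V : Set (Coord n), IsOpen V ∧ p ∈ V ∧ ∃ φ : Coord n → N, MapsTo φ V S ∧
    IsConformalMapOn V g h φ

/-- `s` is, on `O`, a smooth isometric symmetry of `(N, h)` at `q`: it fixes `q`, and its
differential at `q` is `-id`. -/
def IsSymmetryAt (h : TangentForms n N) (q : N) (O : Set N) (s : N → N) : Prop :=
  ContMDiffOn (𝓡 n) (𝓡 n) ∞ s O ∧ s q = q ∧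
    (∀ y ∈ O, ∀ u v : TangentSpace (𝓡 n) y,
      h (s y) (mfderiv (𝓡 n) (𝓡 n) s y u) (mfderiv (𝓡 n) (𝓡 n) s y v) = h y u v) ∧
    ∀ u : Coord n, (mfderiv (𝓡 n) (𝓡 n) s q u : Coord n) = -u

/-- `(N, h)` is a locally symmetric Riemannian manifold: each point has a symmetry that is defined
on a neighbourhood of it. -/
def IsLocallySymmetric (h : TangentForms n N) : Prop :=
  ∀ q : N, ∃ O : Set N, IsOpen O ∧ q ∈ O ∧ ∃ s : N → N, IsSymmetryAt h q O s

/-- `(N, h)` is a Riemannian symmetric space: each point has a globally defined symmetry, which is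
a diffeomorphism of `N`. -/
def IsSymmetric (h : TangentForms n N) : Prop :=
  ∀ q : N, ∃ s : N ≃ N, IsSymmetryAt h q univ s ∧ ContMDiff (𝓡 n) (𝓡 n) ∞ s.symm

theorem IsSymmetric.isLocallySymmetric {h : TangentForms n N} (H : IsSymmetric h) :
    IsLocallySymmetric h := fun q =>
  let ⟨s, hs, _⟩ := H q
  ⟨univ, isOpen_univ, mem_univ q, s, hs⟩

end Symmetric

/-- No neighbourhood of `p` in `(ℝⁿ, g)` is conformally equivalent to an open subset of a locally
symmetric Riemannian manifold (in particular, of a symmetric space). -/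
def NotConformallySymmetricAt {n : ℕ} (p : Coord n) (g : FormField n) : Prop :=
  ∀ (N : Type u) [TopologicalSpace N] [ChartedSpace (Coord n) N] [IsManifold (𝓡 n) ∞ N]
    (h : Bundle.ContMDiffRiemannianMetric (𝓡 n) ∞ (Coord n)
      (fun q : N => TangentSpace (𝓡 n) q)),
    IsLocallySymmetric h.inner → ¬ LocallyConformalAt p g univ h.inner

/-- No neighbourhood of `p` in `(ℝⁿ, g)`, `n = m + 1`, is conformally equivalent to an open subset
of `M²(κ) × ℝⁿ⁻²`. -/
def NotConformalToModelAt {m : ℕ} (κ : ℝ) (p : Coord (m + 1)) (g : FormField (m + 1)) : Prop :=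
  ¬ LocallyConformalAt (N := Coord (m + 1)) p g (modelDomain m κ) (fun q => modelMetric m κ q)

end WeylHom

end

open WeylHom

/-!
The metric `ds²` has the orthonormal coframe `θ⁰ = f dw`, `θⁱ = dxᵢ + ∑ⱼ D_ij xⱼ dw`, whose
connection form is `Ω dw` with a skew-symmetric matrix `Ω` (`isCoframeOn_exFrame`). Hence its
curvature form is `dΩ ∧ dw`, as `dw ∧ dw = 0`, and since `D` depends on `w` only, just the term
with `∂²f / ∂x₁² = ε λ² f` is left. So in the frame the curvature tensor has the constant
components of that of `M²(κ) × ℝⁿ⁻²` (`connCurv_exConn`, `connCurv_modelConn_zero`), which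
determine those of the Weyl tensor. The passage from Cartan's structure equations to the
Christoffel symbols in the definition of the curvature tensor is `IsCoframeOn.apply_curvatureOp`.

Suppose that a neighbourhood of a point `p` is conformally equivalent to an open part of a
locally symmetric space. The symmetry at the image of `p` pulls back to a local conformal map
`s` of `ds²` with `s p = p` and `ds_p = -id` (`exists_conformal_symmetry`). The metric
`s^* ds² = e^{2τ} ds²` has two orthonormal coframes, `s^* θ` and `e^τ θ`. Its curvature
computed from the first is the pull-back of the curvature of `ds²`, and computed from the second
it differs from the curvature of `ds²` by a Kulkarni–Nomizu product with the metric. Evaluated on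
four orthogonal vectors, this shows that near `p` the differential of `s` preserves the planes `E`
spanned by the first two vectors `e₀`, `e₁` of the frame (`area_eq_zero_of_kulkarniNomizu`,
`conformal_preserves_plane`). This replaces the conformal invariance of the Weyl tensor, and is
where `n ≥ 4` enters. Now `[e₀, e₁] mod E` is a tensor `E × E → T / E`, and as `s` acts by `-1`
on all of these spaces at `p`, this tensor vanishes at `p`
(`IsCoframeOn.conn_eq_of_conformal_symmetry`). But its components are `D_i1 / f`, `i > 1`.

The model space has symmetries at all points, half-turns of the surface times reflections of the
flat factor (`exists_isSymmetryAt_model`), so that the same argument applies to it.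
-/

namespace WeylHom

/-! ### Orthonormal coframes and their curvature -/

section

section Invertible

variable {E F : Type*} [NormedAddCommGroup E] [NormedSpace ℝ E] [FiniteDimensional ℝ E]
  [NormedAddCommGroup F] [NormedSpace ℝ F] [FiniteDimensional ℝ F]

theorem isInvertible_of_injective {f : E →L[ℝ] F} (hf : Function.Injective f)
    (h : Module.finrank ℝ E = Module.finrank ℝ F) : f.IsInvertible :=
  ⟨(LinearMap.linearEquivOfInjective (f : E →ₗ[ℝ] F) hf h).toContinuousLinearEquiv, by
    ext x; simp⟩

theorem isInvertible_of_pos {b : E →L[ℝ] E →L[ℝ] ℝ} (hb : ∀ u, u ≠ 0 → 0 < b u u) :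
    b.IsInvertible := by
  refine isInvertible_of_injective ((injective_iff_map_eq_zero b).2 fun u hu => ?_) ?_
  · by_contra h
    have := hb u h
    simp [hu] at this
  · rw [← LinearEquiv.finrank_eq (LinearMap.toContinuousLinearMap (𝕜 := ℝ) (E := E) (F' := ℝ))]
    exact (Subspace.dual_finrank_eq (K := ℝ) (V := E)).symm

end Invertible

variable {n : ℕ}

/-- `A` is an orthonormal coframe of the metric `g` on the open set `U`, and `Θ` its Levi-Civita
connection form. The coframe is encoded by the linear maps `A x : T_x → ℝⁿ` whose components are
the covectors of the coframe, and `Θ x u` is the matrix `Θ(u)`, so that `∇_u` is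
`ξ ↦ ∂_u ξ + Θ(u) ξ` on the frame components `ξ = A v` of a vector field `v`. -/
structure IsCoframeOn (U : Set (Coord n)) (g : FormField n) (A : Coord n → Coord n →L[ℝ] Coord n)
    (Θ : Coord n → Coord n →L[ℝ] Coord n →L[ℝ] Coord n) : Prop where
  isOpen : IsOpen U
  smooth : ContDiffOn ℝ ∞ A U
  smooth_conn : ContDiffOn ℝ ∞ Θ U
  injective : ∀ x ∈ U, Function.Injective (A x)
  metric : ∀ x ∈ U, ∀ u v, g x u v = inner ℝ (A x u) (A x v)
  skew : ∀ x ∈ U, ∀ u ξ η, inner ℝ (Θ x u ξ) η = -inner ℝ ξ (Θ x u η)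
  torsion : ∀ x ∈ U, ∀ u v,
    fderiv ℝ A x u v + Θ x u (A x v) = fderiv ℝ A x v u + Θ x v (A x u)

/-- The curvature `dΘ + Θ ∧ Θ` of a connection form `Θ`. -/
noncomputable def connCurv (Θ : Coord n → Coord n →L[ℝ] Coord n →L[ℝ] Coord n) (x u v : Coord n) :
    Coord n →L[ℝ] Coord n :=
  fderiv ℝ Θ x u v - fderiv ℝ Θ x v u + Θ x u ∘L Θ x v - Θ x v ∘L Θ x u

namespace IsCoframeOn

variable {U : Set (Coord n)} {g : FormField n} {A : Coord n → Coord n →L[ℝ] Coord n}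
  {Θ : Coord n → Coord n →L[ℝ] Coord n →L[ℝ] Coord n} {x : Coord n}

theorem mono (h : IsCoframeOn U g A Θ) {V : Set (Coord n)} (hV : IsOpen V) (hVU : V ⊆ U) :
    IsCoframeOn V g A Θ where
  isOpen := hV
  smooth := h.smooth.mono hVU
  smooth_conn := h.smooth_conn.mono hVU
  injective x hx := h.injective x (hVU hx)
  metric x hx := h.metric x (hVU hx)
  skew x hx := h.skew x (hVU hx)
  torsion x hx := h.torsion x (hVU hx)

theorem isInvertible (h : IsCoframeOn U g A Θ) (hx : x ∈ U) : (A x).IsInvertible :=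
  isInvertible_of_injective (h.injective x hx) rfl

theorem contDiffAt (h : IsCoframeOn U g A Θ) (hx : x ∈ U) : ContDiffAt ℝ ∞ A x :=
  h.smooth.contDiffAt (h.isOpen.mem_nhds hx)

theorem contDiffAt_conn (h : IsCoframeOn U g A Θ) (hx : x ∈ U) : ContDiffAt ℝ ∞ Θ x :=
  h.smooth_conn.contDiffAt (h.isOpen.mem_nhds hx)

theorem differentiableAt (h : IsCoframeOn U g A Θ) (hx : x ∈ U) : DifferentiableAt ℝ A x :=
  (h.contDiffAt hx).differentiableAt (by simp)

theorem differentiableAt_conn (h : IsCoframeOn U g A Θ) (hx : x ∈ U) : DifferentiableAt ℝ Θ x :=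
  (h.contDiffAt_conn hx).differentiableAt (by simp)

theorem contDiffAt_fderiv (h : IsCoframeOn U g A Θ) (hx : x ∈ U) :
    ContDiffAt ℝ ∞ (fderiv ℝ A) x :=
  (h.contDiffAt hx).fderiv_right (by simp)

theorem contDiffAt_inverse (h : IsCoframeOn U g A Θ) (hx : x ∈ U) :
    ContDiffAt ℝ ∞ (fun y => (A y).inverse) x :=
  (h.isInvertible hx).contDiffAt_map_inverse.comp x (h.contDiffAt hx)

theorem apply_inverse (h : IsCoframeOn U g A Θ) (hx : x ∈ U) (ξ : Coord n) :
    A x ((A x).inverse ξ) = ξ := by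
  rw [← ContinuousLinearMap.comp_apply, (h.isInvertible hx).self_comp_inverse]; rfl

theorem inverse_apply (h : IsCoframeOn U g A Θ) (hx : x ∈ U) (u : Coord n) :
    (A x).inverse (A x u) = u := by
  rw [← ContinuousLinearMap.comp_apply, (h.isInvertible hx).inverse_comp_self]; rfl

theorem pos (h : IsCoframeOn U g A Θ) (hx : x ∈ U) {u : Coord n} (hu : u ≠ 0) : 0 < g x u u := by
  rw [h.metric x hx]
  refine real_inner_self_pos.2 fun h0 => hu ?_
  exact h.injective x hx (by rw [h0, map_zero])

theorem form_eq (h : IsCoframeOn U g A Θ) (hx : x ∈ U) :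
    g x = (ContinuousLinearMap.compL ℝ (Coord n) (Coord n) ℝ).flip (A x) ∘L
      (innerSL ℝ : Coord n →L[ℝ] Coord n →L[ℝ] ℝ) ∘L A x := by
  ext u v
  simp [h.metric x hx]
  rfl

theorem smooth_metric (h : IsCoframeOn U g A Θ) : ContDiffOn ℝ ∞ g U := by
  refine ContDiffOn.congr ?_ fun x hx => h.form_eq hx
  exact ContDiffOn.clm_comp ((ContinuousLinearMap.contDiff _).comp_contDiffOn h.smooth)
    (contDiffOn_const.clm_comp h.smooth)

theorem isRiemannianMetricOn (h : IsCoframeOn U g A Θ) : IsRiemannianMetricOn U g where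
  isOpen := h.isOpen
  smooth := h.smooth_metric
  symm x hx u v := by rw [h.metric x hx, h.metric x hx, real_inner_comm]
  pos x hx u hu := h.pos hx hu

theorem fderiv_metric (h : IsCoframeOn U g A Θ) (hx : x ∈ U) (u v w : Coord n) :
    fderiv ℝ g x u v w
      = inner ℝ (fderiv ℝ A x u v) (A x w) + inner ℝ (A x v) (fderiv ℝ A x u w) := by
  have hg : DifferentiableAt ℝ g x :=
    (h.smooth_metric.contDiffAt (h.isOpen.mem_nhds hx)).differentiableAt (by simp)
  have hA := (h.differentiableAt hx).hasFDerivAt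
  have h1 : HasFDerivAt (fun y => g y v w) _ x :=
    (hg.hasFDerivAt.clm_apply (hasFDerivAt_const v x)).clm_apply (hasFDerivAt_const w x)
  have h2 := (hA.clm_apply (hasFDerivAt_const v x)).inner ℝ
    (hA.clm_apply (hasFDerivAt_const w x))
  have h3 := h1.unique (h2.congr_of_eventuallyEq
    (Filter.eventually_of_mem (h.isOpen.mem_nhds hx) fun y hy => h.metric y hy v w))
  have := congrArg (fun L => L u) h3
  simp at this
  rw [this, add_comm]

/-- In an orthonormal coframe, the Levi-Civita connection is `∂_u + Θ(u)`. -/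
theorem apply_christoffel (h : IsCoframeOn U g A Θ) (hx : x ∈ U) (u v : Coord n) :
    A x (christoffel g x u v) = fderiv ℝ A x u v + Θ x u (A x v) := by
  have hinv : (g x).IsInvertible := isInvertible_of_pos fun u hu => h.pos hx hu
  set c := (A x).inverse (fderiv ℝ A x u v + Θ x u (A x v)) with hc
  have hAc : A x c = fderiv ℝ A x u v + Θ x u (A x v) := h.apply_inverse hx _
  have : christoffel g x u v = c := by
    rw [christoffel, sharp, hinv.inverse_apply_eq]
    ext w
    -- the Koszul formula: three instances each of torsion-freeness and of skew-symmetry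
    have t1 := congrArg (fun ξ => inner ℝ ξ (A x w)) (h.torsion x hx u v)
    have t2 := congrArg (fun ξ => inner ℝ ξ (A x v)) (h.torsion x hx u w)
    have t3 := congrArg (fun ξ => inner ℝ ξ (A x u)) (h.torsion x hx v w)
    have s1 := h.skew x hx u (A x v) (A x w)
    have s2 := h.skew x hx v (A x u) (A x w)
    have s3 := h.skew x hx w (A x u) (A x v)
    rw [h.metric x hx c w, hAc]
    simp only [christoffelFirst, smul_apply, sub_apply,
      add_apply, ContinuousLinearMap.flip_apply, h.fderiv_metric hx,
      smul_eq_mul, inner_add_left] at t1 t2 t3 ⊢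
    rw [real_inner_comm (Θ x u (A x w)) (A x v)] at s1
    rw [real_inner_comm (Θ x v (A x w)) (A x u)] at s2
    rw [real_inner_comm (Θ x w (A x v)) (A x u)] at s3
    rw [real_inner_comm (fderiv ℝ A x u w) (A x v), real_inner_comm (fderiv ℝ A x v w) (A x u),
      real_inner_comm (fderiv ℝ A x w v) (A x u)]
    linarith
  rw [this, hAc]

/-- **Cartan's second structure equation**: in an orthonormal coframe, the curvature operator is
`dΘ + Θ ∧ Θ`. -/
theorem apply_curvatureOp (h : IsCoframeOn U g A Θ) (hx : x ∈ U) (u v w : Coord n) :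
    A x (curvatureOp g x u v w) = connCurv Θ x u v (A x w) := by
  have hA := (h.differentiableAt hx).hasFDerivAt
  have hΘ := (h.differentiableAt_conn hx).hasFDerivAt
  have hA' : HasFDerivAt (fderiv ℝ A) _ x :=
    ((h.contDiffAt_fderiv hx).differentiableAt (by simp)).hasFDerivAt
  have hB : DifferentiableAt ℝ (fun y => (A y).inverse) x :=
    (h.contDiffAt_inverse hx).differentiableAt (by simp)
  have hC (v : Coord n) : HasFDerivAt (fun y => fderiv ℝ A y v w + Θ y v (A y w)) _ x :=
    ((hA'.clm_apply (hasFDerivAt_const v x)).clm_apply (hasFDerivAt_const w x)).add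
      ((hΘ.clm_apply (hasFDerivAt_const v x)).clm_apply
        (hA.clm_apply (hasFDerivAt_const w x)))
  have hΓ (v : Coord n) : DifferentiableAt ℝ (fun y => christoffel g y v w) x := by
    refine (hB.clm_apply (hC v).differentiableAt).congr_of_eventuallyEq
      (Filter.eventually_of_mem (h.isOpen.mem_nhds hx) fun y hy => ?_)
    simp only
    rw [← h.apply_christoffel hy, h.inverse_apply hy]
  have key (u v : Coord n) : A x (fderiv ℝ (fun y => christoffel g y v w) x u)
      + fderiv ℝ A x u (christoffel g x v w)
      = fderiv ℝ (fderiv ℝ A) x u v w + fderiv ℝ Θ x u v (A x w) + Θ x v (fderiv ℝ A x u w) := by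
    have h1 := (hA.clm_apply (hΓ v).hasFDerivAt).unique ((hC v).congr_of_eventuallyEq
      (Filter.eventually_of_mem (h.isOpen.mem_nhds hx) fun y hy => h.apply_christoffel hy v w))
    have h2 := congrArg (fun L => L u) h1
    simp at h2
    rw [h2]; abel
  have sym : fderiv ℝ (fderiv ℝ A) x u v = fderiv ℝ (fderiv ℝ A) x v u :=
    (h.contDiffAt hx).isSymmSndFDerivAt (by simp; exact WithTop.coe_le_coe.2 le_top) u v
  have k1 := key u v
  have k2 := key v u
  rw [← eq_sub_iff_add_eq] at k1 k2
  simp only [curvatureOp, connCurv, map_add, map_sub, k1, k2, h.apply_christoffel hx,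
    add_apply, sub_apply, ContinuousLinearMap.comp_apply,
    sym]
  abel

end IsCoframeOn

end

/-! ### Pull-back and conformal change of coframes -/

section

section Calculus

variable {E G : Type*} [NormedAddCommGroup E] [NormedSpace ℝ E] [NormedAddCommGroup G]
  [NormedSpace ℝ G] {x : E}

theorem fderiv_fderiv_comm {s : E → E} (hs : ContDiffAt ℝ ∞ s x) (u v : E) :
    fderiv ℝ (fderiv ℝ s) x u v = fderiv ℝ (fderiv ℝ s) x v u :=
  hs.isSymmSndFDerivAt (by simp; exact WithTop.coe_le_coe.2 le_top) u v

/-- The derivative of the pull-back `s^* C` of a one-form `C`. -/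
theorem fderiv_pullback {C : E → E →L[ℝ] G} {s : E → E} (hC : DifferentiableAt ℝ C (s x))
    (hs : ContDiffAt ℝ ∞ s x) :
    DifferentiableAt ℝ (fun y => C (s y) ∘L fderiv ℝ s y) x ∧ ∀ u v,
      fderiv ℝ (fun y => C (s y) ∘L fderiv ℝ s y) x u v
        = fderiv ℝ C (s x) (fderiv ℝ s x u) (fderiv ℝ s x v)
          + C (s x) (fderiv ℝ (fderiv ℝ s) x u v) := by
  have hd := (hs.differentiableAt (by simp)).hasFDerivAt
  have hd2 : HasFDerivAt (fderiv ℝ s) _ x :=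
    ((hs.fderiv_right (m := 1) (WithTop.coe_le_coe.2 le_top)).differentiableAt
      (by simp)).hasFDerivAt
  have hc : HasFDerivAt (fun y => C (s y)) (fderiv ℝ C (s x) ∘L fderiv ℝ s x) x :=
    hC.hasFDerivAt.comp x hd
  refine ⟨(hc.clm_comp hd2).differentiableAt, fun u v => ?_⟩
  rw [(hc.clm_comp hd2).fderiv]
  simp [add_comm]

theorem fderiv_bilinear_comp {B : E →L[ℝ] E →L[ℝ] G} {A : E → E →L[ℝ] E} {t : E → E}
    (hA : DifferentiableAt ℝ A x) (ht : DifferentiableAt ℝ t x) :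
    DifferentiableAt ℝ (fun y => B.flip (t y) ∘L A y) x ∧ ∀ u v,
      fderiv ℝ (fun y => B.flip (t y) ∘L A y) x u v
        = B (A x v) (fderiv ℝ t x u) + B (fderiv ℝ A x u v) (t x) := by
  have hw : HasFDerivAt (fun y => B.flip (t y)) (B.flip ∘L fderiv ℝ t x) x :=
    B.flip.hasFDerivAt.comp x ht.hasFDerivAt
  have hc := hw.clm_comp hA.hasFDerivAt
  refine ⟨hc.differentiableAt, fun u v => ?_⟩
  rw [hc.fderiv]
  simp [add_comm]

end Calculus

variable {n : ℕ}

namespace IsCoframeOn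

variable {U V : Set (Coord n)} {g g' : FormField n} {A : Coord n → Coord n →L[ℝ] Coord n}
  {Θ : Coord n → Coord n →L[ℝ] Coord n →L[ℝ] Coord n} {x : Coord n} {s : Coord n → Coord n}

/-- The pull-back of a coframe under a local diffeomorphism, with the pull-back of the connection
form. -/
theorem pullback (h : IsCoframeOn U g A Θ) (hV : IsOpen V) (hs : ContDiffOn ℝ ∞ s V)
    (hsU : MapsTo s V U) (hinj : ∀ x ∈ V, Function.Injective (fderiv ℝ s x))
    (hg' : ∀ x ∈ V, ∀ u v, g' x u v = g (s x) (fderiv ℝ s x u) (fderiv ℝ s x v)) :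
    IsCoframeOn V g' (fun y => A (s y) ∘L fderiv ℝ s y) (fun y => Θ (s y) ∘L fderiv ℝ s y) where
  isOpen := hV
  smooth := (h.smooth.comp hs hsU).clm_comp (hs.fderiv_of_isOpen hV (by simp))
  smooth_conn := (h.smooth_conn.comp hs hsU).clm_comp (hs.fderiv_of_isOpen hV (by simp))
  injective x hx := (h.injective _ (hsU hx)).comp (hinj x hx)
  metric x hx u v := by rw [hg' x hx, h.metric _ (hsU hx)]; rfl
  skew x hx u ξ η := h.skew _ (hsU hx) _ ξ η
  torsion x hx u v := by
    have hs1 := hs.contDiffAt (hV.mem_nhds hx)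
    have key := (fderiv_pullback (h.differentiableAt (hsU hx)) hs1).2
    rw [key, key, fderiv_fderiv_comm hs1 u v]
    have := h.torsion _ (hsU hx) (fderiv ℝ s x u) (fderiv ℝ s x v)
    simp only [ContinuousLinearMap.comp_apply]
    rw [add_right_comm, this, add_right_comm]

theorem connCurv_pullback (h : IsCoframeOn U g A Θ) (hV : IsOpen V) (hs : ContDiffOn ℝ ∞ s V)
    (hsU : MapsTo s V U) (hx : x ∈ V) (u v : Coord n) :
    connCurv (fun y => Θ (s y) ∘L fderiv ℝ s y) x u v
      = connCurv Θ (s x) (fderiv ℝ s x u) (fderiv ℝ s x v) := by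
  have hs1 := hs.contDiffAt (hV.mem_nhds hx)
  have key := (fderiv_pullback (h.differentiableAt_conn (hsU hx)) hs1).2
  rw [connCurv, connCurv, key, key, fderiv_fderiv_comm hs1 u v]
  simp only [ContinuousLinearMap.comp_apply]
  abel

end IsCoframeOn

/-- The skew-symmetric map `a ∧ b : ξ ↦ ⟨b, ξ⟩ a - ⟨a, ξ⟩ b`. -/
noncomputable def wedge : Coord n →L[ℝ] Coord n →L[ℝ] Coord n →L[ℝ] Coord n :=
  let S : Coord n →L[ℝ] Coord n →L[ℝ] Coord n →L[ℝ] Coord n :=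
    (ContinuousLinearMap.smulRightL ℝ (Coord n) (Coord n)) ∘L
      (innerSL ℝ : Coord n →L[ℝ] Coord n →L[ℝ] ℝ)
  S.flip - S

theorem wedge_apply (a b ξ : Coord n) :
    wedge a b ξ = (inner ℝ b ξ : ℝ) • a - (inner ℝ a ξ : ℝ) • b := rfl

namespace IsCoframeOn

variable {U : Set (Coord n)} {g g' : FormField n} {A : Coord n → Coord n →L[ℝ] Coord n}
  {Θ : Coord n → Coord n →L[ℝ] Coord n →L[ℝ] Coord n} {x : Coord n} {τ : Coord n → ℝ}
  {t : Coord n → Coord n}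

/-- The frame components of the gradient of a function. -/
theorem exists_grad (h : IsCoframeOn U g A Θ) (hτ : ContDiffOn ℝ ∞ τ U) :
    ∃ t : Coord n → Coord n, ContDiffOn ℝ ∞ t U ∧
      ∀ x ∈ U, ∀ u, inner ℝ (t x) (A x u) = fderiv ℝ τ x u := by
  refine ⟨fun x => ∑ i : Fin n,
    fderiv ℝ τ x ((A x).inverse (EuclideanSpace.single i 1)) • EuclideanSpace.single i 1, ?_, ?_⟩
  · refine ContDiffOn.sum fun i _ => ContDiffOn.fun_smul ?_ contDiffOn_const
    refine (hτ.fderiv_of_isOpen h.isOpen (by simp)).clm_apply (ContDiffOn.clm_apply ?_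
      contDiffOn_const)
    exact fun x hx => (h.contDiffAt_inverse hx).contDiffWithinAt
  · intro x hx u
    conv_rhs => rw [← h.inverse_apply hx u]
    have : A x u = ∑ i : Fin n, (A x u i) • EuclideanSpace.single i (1 : ℝ) := by
      ext j; simp [Finset.sum_apply, Pi.single_apply]
    rw [sum_inner]
    conv_rhs => rw [this]
    simp [inner_smul_left, EuclideanSpace.inner_single_left, mul_comm]

theorem fderiv_conformal (h : IsCoframeOn U g A Θ) (hτ : ContDiffOn ℝ ∞ τ U) (hx : x ∈ U)
    (u v : Coord n) :
    fderiv ℝ (fun y => Real.exp (τ y) • A y) x u v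
      = Real.exp (τ x) • (fderiv ℝ A x u v + fderiv ℝ τ x u • A x v) := by
  have hd := ((hτ.contDiffAt (h.isOpen.mem_nhds hx)).differentiableAt (by simp)).hasFDerivAt
  rw [(hd.exp.fun_smul (h.differentiableAt hx).hasFDerivAt).fderiv]
  simp [smul_smul]

/-- An orthonormal coframe `e^τ A` of the conformally changed metric `e^{2τ} g`. -/
theorem conformal (h : IsCoframeOn U g A Θ) (hτ : ContDiffOn ℝ ∞ τ U) (ht : ContDiffOn ℝ ∞ t U)
    (htτ : ∀ x ∈ U, ∀ u, inner ℝ (t x) (A x u) = fderiv ℝ τ x u)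
    (hg' : ∀ x ∈ U, ∀ u v, g' x u v = Real.exp (2 * τ x) * g x u v) :
    IsCoframeOn U g' (fun y => Real.exp (τ y) • A y)
      (fun y => Θ y + wedge.flip (t y) ∘L A y) where
  isOpen := h.isOpen
  smooth := hτ.exp.smul h.smooth
  smooth_conn := h.smooth_conn.add
    (((ContinuousLinearMap.contDiff _).comp_contDiffOn ht).clm_comp h.smooth)
  injective x hx := by
    intro u v huv
    refine h.injective x hx (smul_right_injective _ (Real.exp_pos (τ x)).ne' ?_)
    simpa using huv
  metric x hx u v := by
    rw [hg' x hx, h.metric x hx, two_mul, Real.exp_add]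
    simp [inner_smul_left, inner_smul_right, mul_assoc]
  skew x hx u ξ η := by
    have := h.skew x hx u ξ η
    simp [wedge_apply, inner_add_left, inner_add_right, inner_sub_left, inner_sub_right,
      inner_smul_left, inner_smul_right, this]
    rw [real_inner_comm ξ (A x u), real_inner_comm ξ (t x)]
    ring
  torsion x hx u v := by
    rw [h.fderiv_conformal hτ hx, h.fderiv_conformal hτ hx]
    have := h.torsion x hx u v
    rw [← eq_sub_iff_add_eq] at this
    simp [wedge_apply, this, htτ x hx, real_inner_comm (A x u) (A x v)]
    module

theorem fderiv_conn_conformal (h : IsCoframeOn U g A Θ) (ht : ContDiffOn ℝ ∞ t U) (hx : x ∈ U)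
    (u v : Coord n) :
    fderiv ℝ (fun y => Θ y + wedge.flip (t y) ∘L A y) x u v
      = fderiv ℝ Θ x u v + wedge (A x v) (fderiv ℝ t x u) + wedge (fderiv ℝ A x u v) (t x) := by
  have hd := (ht.contDiffAt (h.isOpen.mem_nhds hx)).differentiableAt (by simp)
  have key := fderiv_bilinear_comp (B := wedge) (h.differentiableAt hx) hd
  rw [fderiv_fun_add (h.differentiableAt_conn hx) key.1, add_apply, add_apply, key.2, add_assoc]

/-- Under a conformal change of the metric, the curvature changes by a Kulkarni–Nomizu product
with the metric. -/
theorem connCurv_conformal (h : IsCoframeOn U g A Θ) (ht : ContDiffOn ℝ ∞ t U) (hx : x ∈ U) :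
    ∃ P : Coord n → Coord n, ∀ u v,
      connCurv (fun y => Θ y + wedge.flip (t y) ∘L A y) x u v
        = connCurv Θ x u v + wedge (A x v) (P u) - wedge (A x u) (P v) := by
  refine ⟨fun u => fderiv ℝ t x u + Θ x u (t x) - (inner ℝ (t x) (A x u) : ℝ) • t x
    + ((inner ℝ (t x) (t x) : ℝ) / 2) • A x u, fun u v => ?_⟩
  have tor := h.torsion x hx u v
  rw [← eq_sub_iff_add_eq] at tor
  have sk (u a b : Coord n) : inner ℝ a (Θ x u b) = -(inner ℝ (Θ x u a) b : ℝ) := by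
    rw [h.skew x hx, neg_neg]
  rw [connCurv, connCurv, h.fderiv_conn_conformal ht hx, h.fderiv_conn_conformal ht hx, tor]
  ext1 ξ
  simp only [ContinuousLinearMap.comp_apply, sub_apply, add_apply, smul_apply, wedge_apply,
    ContinuousLinearMap.flip_apply, map_add, map_sub, map_smul, sk, smul_add, smul_sub,
    real_inner_comm (t x) (A x u), real_inner_comm (t x) (A x v),
    real_inner_comm (A x u) (A x v)]
  module

end IsCoframeOn

end

/-! ### Product curvature tensors -/

section

variable {n : ℕ}

/-- The infinitesimal rotation in the plane of the coordinates `a` and `b`. -/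
noncomputable def rot (a b : Fin n) : Coord n →L[ℝ] Coord n :=
  wedge (EuclideanSpace.single a 1) (EuclideanSpace.single b 1)

/-- The area form of the plane of the coordinates `a` and `b`. -/
def area (a b : Fin n) (ξ η : Coord n) : ℝ := ξ a * η b - ξ b * η a

theorem rot_apply (a b : Fin n) (ξ : Coord n) :
    rot a b ξ = ξ b • EuclideanSpace.single a (1 : ℝ) - ξ a • EuclideanSpace.single b (1 : ℝ) := by
  simp [rot, wedge_apply, EuclideanSpace.inner_single_left]

theorem inner_rot (a b : Fin n) (ξ η : Coord n) : inner ℝ (rot a b ξ) η = -area a b ξ η := by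
  simp [rot_apply, area, inner_sub_left, inner_smul_left, EuclideanSpace.inner_single_left]

theorem inner_rot_right (a b : Fin n) (ξ η : Coord n) :
    inner ℝ ξ (rot a b η) = -(inner ℝ (rot a b ξ) η : ℝ) := by
  rw [real_inner_comm, inner_rot, inner_rot, area, area]
  ring

/-- `g` has at `x` the curvature tensor of the product of a surface of curvature `K`, tangent to the
`a`-th and `b`-th vectors of an orthonormal frame, and a flat space. -/
def HasProductCurvature (K : ℝ) (a b : Fin n) (g : FormField n) (x : Coord n) : Prop :=
  ∃ A : Coord n ≃L[ℝ] Coord n, (∀ u v, g x u v = inner ℝ (A u) (A v)) ∧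
    ∀ u v w, A (curvatureOp g x u v w) = (K * area a b (A u) (A v)) • rot a b (A w)

theorem IsCoframeOn.hasProductCurvature {U : Set (Coord n)} {g : FormField n}
    {A : Coord n → Coord n →L[ℝ] Coord n} {Θ : Coord n → Coord n →L[ℝ] Coord n →L[ℝ] Coord n}
    (h : IsCoframeOn U g A Θ) {x : Coord n} (hx : x ∈ U) {K : ℝ} {a b : Fin n}
    (hΘ : ∀ u v, connCurv Θ x u v = (K * area a b (A x u) (A x v)) • rot a b) :
    HasProductCurvature K a b g x := by
  obtain ⟨e, he⟩ := h.isInvertible hx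
  have he' (u) : e u = A x u := by rw [← he]; rfl
  refine ⟨e, fun u v => ?_, fun u v w => ?_⟩
  · rw [he', he', h.metric x hx]
  · simp only [he']
    rw [h.apply_curvatureOp hx, hΘ]; rfl

theorem sum_conj (e : Coord n ≃L[ℝ] Coord n) (T : Coord n →L[ℝ] Coord n) :
    ∑ i, e.symm (T (e (EuclideanSpace.single i 1))) i = LinearMap.trace ℝ (Coord n) T := by
  rw [← LinearMap.trace_conj' (T : Coord n →ₗ[ℝ] Coord n) e.symm.toLinearEquiv,
    LinearMap.trace_eq_sum_inner _ (EuclideanSpace.basisFun (Fin n) ℝ)]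
  simp [EuclideanSpace.inner_single_left, LinearEquiv.conj_apply]

section Tensors

variable {g : FormField n} {x : Coord n} {K : ℝ} {a b : Fin n} {A : Coord n ≃L[ℝ] Coord n}

theorem riemann_eq (hg : ∀ u v, g x u v = inner ℝ (A u) (A v))
    (hR : ∀ u v w, A (curvatureOp g x u v w) = (K * area a b (A u) (A v)) • rot a b (A w))
    (u v w z : Coord n) :
    riemann g x u v w z = -K * area a b (A u) (A v) * area a b (A w) (A z) := by
  rw [riemann, hg, hR, real_inner_smul_left, inner_rot]
  ring

theorem ricci_eq
    (hR : ∀ u v w, A (curvatureOp g x u v w) = (K * area a b (A u) (A v)) • rot a b (A w))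
    (v w : Coord n) :
    ricci g x v w = -K * inner ℝ (rot a b (rot a b (A w))) (A v) := by
  let T : Coord n →L[ℝ] Coord n :=
    (K • (innerSL ℝ (rot a b (A v)) : Coord n →L[ℝ] ℝ)).smulRight (rot a b (A w))
  have hT (ξ) : T ξ = (K * area a b ξ (A v)) • rot a b (A w) := by
    have : area a b ξ (A v) = inner ℝ (rot a b (A v)) ξ := by
      rw [inner_rot, area, area]; ring
    rw [this]; rfl
  have h1 : ricci g x v w = ∑ i, A.symm (T (A (EuclideanSpace.single i 1))) i := by
    refine Finset.sum_congr rfl fun i _ => ?_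
    rw [hT, ← hR, A.symm_apply_apply]; rfl
  have h2 : ∑ i, T (EuclideanSpace.single i 1) i = LinearMap.trace ℝ (Coord n) T :=
    sum_conj (ContinuousLinearEquiv.refl ℝ _) T
  rw [h1, sum_conj, ← h2, inner_rot]
  simp only [hT, area, rot_apply]
  simp [Finset.sum_sub_distrib, sub_mul, mul_sub]
  split_ifs <;> ring

theorem scal_eq (hg : ∀ u v, g x u v = inner ℝ (A u) (A v))
    (hR : ∀ u v w, A (curvatureOp g x u v w) = (K * area a b (A u) (A v)) • rot a b (A w)) :
    scal g x = -K * LinearMap.trace ℝ (Coord n) (rot a b ∘L rot a b) := by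
  have hinv : (g x).IsInvertible := isInvertible_of_pos fun u hu => by
    rw [hg]
    exact real_inner_self_pos.2 (by simpa using hu)
  have hs (α : Coord n →L[ℝ] ℝ) (v : Coord n) : inner ℝ (A (sharp g x α)) (A v) = α v := by
    rw [← hg, sharp, ← ContinuousLinearMap.comp_apply (g x), hinv.self_comp_inverse]; rfl
  rw [scal, ← sum_conj A, Finset.mul_sum]
  refine Finset.sum_congr rfl fun i _ => ?_
  rw [ricci_eq hR]
  have : inner ℝ (rot a b (rot a b (A (sharp g x (dcoord i))))) (A (EuclideanSpace.single i 1))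
    = (inner ℝ (A (sharp g x (dcoord i)))
        (rot a b (rot a b (A (EuclideanSpace.single i 1)))) : ℝ) := by
    rw [inner_rot_right, inner_rot_right, neg_neg]
  rw [this]
  have := hs (dcoord i) (A.symm (rot a b (rot a b (A (EuclideanSpace.single i 1)))))
  rw [A.apply_symm_apply] at this
  rw [this]; rfl

end Tensors

namespace HasProductCurvature

variable {K : ℝ} {a b : Fin n} {g h : FormField n} {x y : Coord n}

theorem sameCurvature (hg : HasProductCurvature K a b g x) (hh : HasProductCurvature K a b h y) :
    SameCurvature g x h y := by
  obtain ⟨A, hA, hR⟩ := hg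
  obtain ⟨B, hB, hS⟩ := hh
  refine ⟨(A.trans B.symm).toLinearEquiv, fun u v => ?_, fun u v w z => ?_⟩
  · rw [hA, hB]; simp
  · rw [riemann_eq hA hR, riemann_eq hB hS]; simp

theorem sameWeyl (hg : HasProductCurvature K a b g x) (hh : HasProductCurvature K a b h y) :
    SameWeyl g x h y := by
  obtain ⟨A, hA, hR⟩ := hg
  obtain ⟨B, hB, hS⟩ := hh
  refine ⟨(A.trans B.symm).toLinearEquiv, 1, one_pos, fun u v => ?_, fun u v w z => ?_⟩
  · rw [hA, hB]; simp
  · simp only [one_mul, weyl, schouten, riemann_eq hA hR, riemann_eq hB hS, ricci_eq hR,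
      ricci_eq hS, scal_eq hA hR, scal_eq hB hS, hA, hB]
    simp

end HasProductCurvature

end

/-! ### The coframe of `ds²` -/

section

/-- A map with values in endomorphisms of `ℝⁿ` can be differentiated entry by entry. -/
theorem fderiv_apply_coord {n : ℕ} {A : Coord n → Coord n →L[ℝ] Coord n} {x : Coord n}
    (hA : DifferentiableAt ℝ A x) (u v : Coord n) (i : Fin n) :
    fderiv ℝ A x u v i = fderiv ℝ (fun y => A y v i) x u := by
  have h1 := hA.hasFDerivAt.clm_apply (hasFDerivAt_const v x)
  have h2 := ((EuclideanSpace.proj i : Coord n →L[ℝ] ℝ).hasFDerivAt (x := A x v)).comp x h1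
  have h3 := h2.fderiv
  simp only [Function.comp_def, EuclideanSpace.coe_proj] at h3
  rw [h3]
  simp

theorem fderiv_smulRight {E G : Type*} [NormedAddCommGroup E] [NormedSpace ℝ E]
    [NormedAddCommGroup G] [NormedSpace ℝ G] {M : E → G} {x : E} (hM : DifferentiableAt ℝ M x)
    (θ : E →L[ℝ] ℝ) (u v : E) :
    fderiv ℝ (fun y => θ.smulRight (M y)) x u v = θ v • fderiv ℝ M x u := by
  have h : HasFDerivAt (fun y => θ.smulRight (M y))
      (ContinuousLinearMap.smulRightL ℝ E G θ ∘L fderiv ℝ M x) x :=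
    (ContinuousLinearMap.smulRightL ℝ E G θ).hasFDerivAt.comp x hM.hasFDerivAt
  rw [h.fderiv]; rfl

section Warp

theorem warp_def (ε : ℤˣ) (l : ℝ) (a b : ℝ → ℝ) (x w : ℝ) :
    warp ε l a b x w = a w * warp ε l 1 0 x w + b w * warp ε l 0 1 x w := by
  unfold warp; split_ifs <;> simp

/-- The coefficients of `∂_x f_ε`, which is again a function of the form `f_ε`. -/
noncomputable def warpCoeff (ε : ℤˣ) (l : ℝ) (a b : ℝ → ℝ) : (ℝ → ℝ) × (ℝ → ℝ) :=
  if ε = 1 then (fun w => l * a w, fun w => -(l * b w))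
  else (fun w => l * b w, fun w => -(l * a w))

/-- The derivative `∂_x f_ε(x, w)`. -/
noncomputable def warpDeriv (ε : ℤˣ) (l : ℝ) (a b : ℝ → ℝ) (x w : ℝ) : ℝ :=
  warp ε l (warpCoeff ε l a b).1 (warpCoeff ε l a b).2 x w

variable (ε : ℤˣ) (l : ℝ) (a b : ℝ → ℝ)

/-- The equation `∂²f_ε / ∂x² = ε l² f_ε`. -/
theorem warpDeriv_warpCoeff (x w : ℝ) :
    warpDeriv ε l (warpCoeff ε l a b).1 (warpCoeff ε l a b).2 x w
      = ((ε : ℤ) : ℝ) * l ^ 2 * warp ε l a b x w := by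
  rcases Int.units_eq_one_or ε with rfl | rfl
  · simp [warpDeriv, warpCoeff, warp]; ring
  · have : ¬ ((-1 : ℤˣ) = 1) := by decide
    simp [warpDeriv, warpCoeff, warp, this]; ring

theorem hasDerivAt_warp (x w : ℝ) :
    HasDerivAt (fun x => warp ε l a b x w) (warpDeriv ε l a b x w) x := by
  have hl : HasDerivAt (fun x : ℝ => l * x) l x := by simpa using (hasDerivAt_id x).const_mul l
  rcases Int.units_eq_one_or ε with rfl | rfl
  · have := (hl.exp.const_mul (a w)).fun_add (hl.fun_neg.exp.const_mul (b w))
    simp only [warp, warpDeriv, warpCoeff, if_true]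
    exact this.congr_deriv (by ring)
  · have h1 : ¬ ((-1 : ℤˣ) = 1) := by decide
    have := (hl.cos.const_mul (a w)).fun_add (hl.sin.const_mul (b w))
    simp only [warp, warpDeriv, warpCoeff, if_neg h1]
    exact this.congr_deriv (by ring)

variable {ε l a b} {I : Set ℝ}

theorem contDiff_warp_const (ε : ℤˣ) (l : ℝ) (a b w : ℝ) :
    ContDiff ℝ ∞ (fun x => warp ε l (fun _ => a) (fun _ => b) x w) := by
  unfold warp
  split_ifs <;> fun_prop

theorem contDiffOn_warpCoeff (ha : ContDiffOn ℝ ∞ a I) (hb : ContDiffOn ℝ ∞ b I) :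
    ContDiffOn ℝ ∞ (warpCoeff ε l a b).1 I ∧ ContDiffOn ℝ ∞ (warpCoeff ε l a b).2 I := by
  unfold warpCoeff
  split_ifs
  · exact ⟨contDiffOn_const.mul ha, (contDiffOn_const.mul hb).neg⟩
  · exact ⟨contDiffOn_const.mul hb, (contDiffOn_const.mul ha).neg⟩

variable {n : ℕ} {i j : Fin n} {p : Coord n}

theorem contDiff_coord (i : Fin n) : ContDiff ℝ ∞ (fun p : Coord n => p i) :=
  (EuclideanSpace.proj i : Coord n →L[ℝ] ℝ).contDiff

theorem hasFDerivAt_coord (i : Fin n) : HasFDerivAt (fun p : Coord n => p i) (dcoord i) p :=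
  (EuclideanSpace.proj i : Coord n →L[ℝ] ℝ).hasFDerivAt

theorem contDiffOn_comp_coord (ha : ContDiffOn ℝ ∞ a I) (i : Fin n) :
    ContDiffOn ℝ ∞ (fun p : Coord n => a (p i)) {p | p i ∈ I} :=
  ha.comp (contDiff_coord i).contDiffOn fun _ hp => hp

theorem contDiffOn_warp (ha : ContDiffOn ℝ ∞ a I) (hb : ContDiffOn ℝ ∞ b I) (i j : Fin n) :
    ContDiffOn ℝ ∞ (fun p : Coord n => warp ε l a b (p j) (p i)) {p | p i ∈ I} := by
  have h1 := contDiffOn_comp_coord ha i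
  have h2 := contDiffOn_comp_coord hb i
  have h3 : ContDiffOn ℝ ∞ (fun p : Coord n => p j) {p | p i ∈ I} := (contDiff_coord j).contDiffOn
  have h4 : ContDiffOn ℝ ∞ (fun p : Coord n => l * p j) {p | p i ∈ I} := contDiffOn_const.mul h3
  unfold warp
  split_ifs
  · exact (h1.mul h4.exp).add (h2.mul h4.neg.exp)
  · exact (h1.mul h4.cos).add (h2.mul h4.sin)

theorem hasFDerivAt_comp_coord (hI : IsOpen I) (ha : ContDiffOn ℝ ∞ a I) (i : Fin n)
    (hp : p i ∈ I) :
    HasFDerivAt (fun p : Coord n => a (p i)) (deriv a (p i) • dcoord i) p :=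
  (((ha.contDiffAt (hI.mem_nhds hp)).differentiableAt
    (by simp)).hasDerivAt).comp_hasFDerivAt p (hasFDerivAt_coord i)

theorem hasFDerivAt_warp (hI : IsOpen I) (ha : ContDiffOn ℝ ∞ a I) (hb : ContDiffOn ℝ ∞ b I)
    (i j : Fin n) (hp : p i ∈ I) :
    HasFDerivAt (fun p : Coord n => warp ε l a b (p j) (p i))
      (warp ε l (deriv a) (deriv b) (p j) (p i) • dcoord i
        + warpDeriv ε l a b (p j) (p i) • dcoord j) p := by
  have h1 := hasFDerivAt_comp_coord hI ha i hp
  have h2 := hasFDerivAt_comp_coord hI hb i hp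
  have h3 := (hasDerivAt_warp ε l 1 0 (p j) 0).comp_hasFDerivAt p (hasFDerivAt_coord j)
  have h4 := (hasDerivAt_warp ε l 0 1 (p j) 0).comp_hasFDerivAt p (hasFDerivAt_coord j)
  have h := (h1.mul h3).add (h2.mul h4)
  have e1 : (fun p : Coord n => warp ε l a b (p j) (p i)) = _ :=
    funext fun p => warp_def ε l a b (p j) (p i)
  rw [e1]
  refine h.congr_fderiv ?_
  ext u
  simp only [warp, warpDeriv, warpCoeff]
  split_ifs <;> simp <;> ring

end Warp

section Example

variable {m : ℕ}

/-- The linear map of `ℝ^{m+1}` which is `M` on the last `m` coordinates. -/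
noncomputable def tailMap (M : Matrix (Fin m) (Fin m) ℝ) : Coord (m + 1) →L[ℝ] Coord (m + 1) :=
  ∑ i : Fin m, ∑ j : Fin m, M i j • (dcoord j.succ).smulRight (EuclideanSpace.single i.succ (1 : ℝ))

theorem dcoord_apply {n : ℕ} (i : Fin n) (u : Coord n) : dcoord i u = u i := rfl

@[simp]
theorem tailMap_zero (M : Matrix (Fin m) (Fin m) ℝ) (ξ : Coord (m + 1)) : tailMap M ξ 0 = 0 := by
  simp [tailMap, Fin.succ_ne_zero]

@[simp]
theorem tailMap_succ (M : Matrix (Fin m) (Fin m) ℝ) (ξ : Coord (m + 1)) (i : Fin m) :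
    tailMap M ξ i.succ = ∑ j, M i j * ξ j.succ := by
  simp [tailMap, Pi.single_apply, dcoord_apply, Finset.sum_ite_eq]

theorem inner_coord_succ (ξ η : Coord (m + 1)) :
    inner ℝ ξ η = ξ 0 * η 0 + ∑ i : Fin m, ξ i.succ * η i.succ := by
  simp [PiLp.inner_apply, Fin.sum_univ_succ, mul_comm]

theorem inner_tailMap {M : Matrix (Fin m) (Fin m) ℝ} (hM : M.transpose = -M)
    (ξ η : Coord (m + 1)) : inner ℝ (tailMap M ξ) η = -(inner ℝ ξ (tailMap M η) : ℝ) := by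
  have hM' (i j) : M i j = -M j i := by
    have := congrFun (congrFun hM j) i
    simpa using this
  rw [inner_coord_succ, inner_coord_succ]
  simp only [tailMap_zero, tailMap_succ, zero_mul, mul_zero, zero_add, Finset.sum_mul,
    Finset.mul_sum]
  rw [Finset.sum_comm, ← Finset.sum_neg_distrib]
  refine Finset.sum_congr rfl fun i _ => ?_
  rw [← Finset.sum_neg_distrib]
  refine Finset.sum_congr rfl fun j _ => ?_
  rw [hM' j i]; ring

variable {D : ℝ → Matrix (Fin m) (Fin m) ℝ} {I : Set ℝ} {p : Coord (m + 1)}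

theorem isOpen_strip (hI : IsOpen I) : IsOpen {p : Coord (m + 1) | p 0 ∈ I} :=
  hI.preimage (contDiff_coord (0 : Fin (m + 1))).continuous

theorem contDiffOn_tailMap (hD : ∀ i j, ContDiffOn ℝ ∞ (fun w => D w i j) I) :
    ContDiffOn ℝ ∞ (fun p : Coord (m + 1) => tailMap (D (p 0))) {p | p 0 ∈ I} :=
  ContDiffOn.sum fun i _ => ContDiffOn.sum fun j _ =>
    (contDiffOn_comp_coord (hD i j) 0).smul contDiffOn_const

theorem hasFDerivAt_tailMap (hI : IsOpen I) (hD : ∀ i j, ContDiffOn ℝ ∞ (fun w => D w i j) I)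
    (hp : p 0 ∈ I) :
    HasFDerivAt (fun p : Coord (m + 1) => tailMap (D (p 0)))
      ((dcoord 0).smulRight (tailMap fun i j => deriv (fun w => D w i j) (p 0))) p := by
  have h : HasFDerivAt (fun p : Coord (m + 1) => tailMap (D (p 0))) _ p :=
    HasFDerivAt.fun_sum fun i _ => HasFDerivAt.fun_sum fun j _ =>
      (hasFDerivAt_comp_coord hI (hD i j) 0 hp).smul_const
        ((dcoord j.succ).smulRight (EuclideanSpace.single i.succ (1 : ℝ)))
  refine h.congr_fderiv ?_
  ext1 u
  simp [tailMap, Finset.smul_sum, smul_smul, mul_comm, dcoord_apply]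

variable [NeZero m]

/-- The coframe `θ⁰ = f dw`, `θⁱ = dxᵢ + ∑ⱼ D_ij xⱼ dw` of `ds²`. -/
noncomputable def exFrame (ε : ℤˣ) (l : ℝ) (a b : ℝ → ℝ) (D : ℝ → Matrix (Fin m) (Fin m) ℝ)
    (p : Coord (m + 1)) : Coord (m + 1) →L[ℝ] Coord (m + 1) :=
  (warp ε l a b (p (Fin.succ 0)) (p 0) • dcoord 0).smulRight (EuclideanSpace.single 0 (1 : ℝ))
    + ∑ i : Fin m, (dcoord i.succ + (∑ j : Fin m, D (p 0) i j * p j.succ) • dcoord 0).smulRight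
        (EuclideanSpace.single i.succ (1 : ℝ))

/-- The matrix `Ω` in the connection form `Ω dw` of `ds²`. -/
noncomputable def exMat (ε : ℤˣ) (l : ℝ) (a b : ℝ → ℝ) (D : ℝ → Matrix (Fin m) (Fin m) ℝ)
    (p : Coord (m + 1)) : Coord (m + 1) →L[ℝ] Coord (m + 1) :=
  warpDeriv ε l a b (p (Fin.succ 0)) (p 0) • rot 0 (Fin.succ 0) + tailMap (D (p 0))

/-- The connection form of `ds²`. -/
noncomputable def exConn (ε : ℤˣ) (l : ℝ) (a b : ℝ → ℝ) (D : ℝ → Matrix (Fin m) (Fin m) ℝ)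
    (p : Coord (m + 1)) : Coord (m + 1) →L[ℝ] Coord (m + 1) →L[ℝ] Coord (m + 1) :=
  (dcoord 0).smulRight (exMat ε l a b D p)

variable {ε : ℤˣ} {l : ℝ} {a b : ℝ → ℝ}

theorem exFrame_zero (u : Coord (m + 1)) :
    exFrame ε l a b D p u 0 = warp ε l a b (p (Fin.succ 0)) (p 0) * u 0 := by
  simp [exFrame, dcoord_apply]

theorem exFrame_succ (u : Coord (m + 1)) (i : Fin m) :
    exFrame ε l a b D p u i.succ = u i.succ + (∑ j, D (p 0) i j * p j.succ) * u 0 := by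
  simp [exFrame, dcoord_apply, Pi.single_apply, Finset.sum_ite_eq]

theorem exMat_zero (ξ : Coord (m + 1)) :
    exMat ε l a b D p ξ 0 = warpDeriv ε l a b (p (Fin.succ 0)) (p 0) * ξ (Fin.succ 0) := by
  simp [exMat, rot_apply]

theorem exMat_succ (ξ : Coord (m + 1)) (i : Fin m) :
    exMat ε l a b D p ξ i.succ
      = (if i = 0 then -(warpDeriv ε l a b (p (Fin.succ 0)) (p 0) * ξ 0) else 0)
        + ∑ j, D (p 0) i j * ξ j.succ := by
  have h : i.succ = Fin.succ 0 ↔ i = 0 := Fin.succ_inj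
  simp only [exMat, add_apply, PiLp.add_apply, tailMap_succ, smul_apply, PiLp.smul_apply,
    rot_apply, PiLp.sub_apply, PiLp.single_apply, h, Fin.succ_ne_zero, if_false]
  split_ifs <;> simp

theorem isOpen_exDomain (hI : IsOpen I) (ha : ContDiffOn ℝ ∞ a I) (hb : ContDiffOn ℝ ∞ b I) :
    IsOpen (exDomain (m := m) I ε l a b) :=
  (contDiffOn_warp ha hb 0 (Fin.succ 0)).continuousOn.isOpen_inter_preimage (isOpen_strip hI)
    isOpen_compl_singleton

theorem contDiffOn_exFrame (ha : ContDiffOn ℝ ∞ a I) (hb : ContDiffOn ℝ ∞ b I)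
    (hD : ∀ i j, ContDiffOn ℝ ∞ (fun w => D w i j) I) :
    ContDiffOn ℝ ∞ (exFrame ε l a b D) {p | p 0 ∈ I} := by
  refine ContDiffOn.add (ContDiffOn.smulRight ((contDiffOn_warp ha hb 0 _).smul contDiffOn_const)
    contDiffOn_const) (ContDiffOn.sum fun i _ => ContDiffOn.smulRight (contDiffOn_const.add
      (ContDiffOn.fun_smul (ContDiffOn.sum fun j _ => ?_) contDiffOn_const)) contDiffOn_const)
  exact (contDiffOn_comp_coord (hD i j) 0).mul (contDiff_coord j.succ).contDiffOn

theorem fderiv_exFrame_zero (hI : IsOpen I) (ha : ContDiffOn ℝ ∞ a I) (hb : ContDiffOn ℝ ∞ b I)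
    (hD : ∀ i j, ContDiffOn ℝ ∞ (fun w => D w i j) I) (hp : p 0 ∈ I) (u v : Coord (m + 1)) :
    fderiv ℝ (exFrame ε l a b D) p u v 0
      = (warp ε l (deriv a) (deriv b) (p (Fin.succ 0)) (p 0) * u 0
        + warpDeriv ε l a b (p (Fin.succ 0)) (p 0) * u (Fin.succ 0)) * v 0 := by
  have hd := (((contDiffOn_exFrame (ε := ε) (l := l) ha hb hD).contDiffAt
    ((isOpen_strip hI).mem_nhds hp))).differentiableAt (by simp)
  rw [fderiv_apply_coord hd]
  simp only [exFrame_zero]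
  rw [((hasFDerivAt_warp hI ha hb 0 (Fin.succ 0) hp).mul_const (v 0)).fderiv]
  simp [dcoord_apply]
  ring

theorem fderiv_exFrame_succ (hI : IsOpen I) (ha : ContDiffOn ℝ ∞ a I) (hb : ContDiffOn ℝ ∞ b I)
    (hD : ∀ i j, ContDiffOn ℝ ∞ (fun w => D w i j) I) (hp : p 0 ∈ I) (u v : Coord (m + 1))
    (i : Fin m) :
    fderiv ℝ (exFrame ε l a b D) p u v i.succ
      = ((∑ j, deriv (fun w => D w i j) (p 0) * p j.succ) * u 0
        + ∑ j, D (p 0) i j * u j.succ) * v 0 := by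
  have hd := (((contDiffOn_exFrame (ε := ε) (l := l) ha hb hD).contDiffAt
    ((isOpen_strip hI).mem_nhds hp))).differentiableAt (by simp)
  rw [fderiv_apply_coord hd]
  simp only [exFrame_succ]
  have h : HasFDerivAt (fun p : Coord (m + 1) => ∑ j, D (p 0) i j * p j.succ) _ p :=
    HasFDerivAt.fun_sum fun j _ =>
      (hasFDerivAt_comp_coord hI (hD i j) 0 hp).fun_mul (hasFDerivAt_coord j.succ)
  rw [((h.mul_const (v 0)).const_add (v i.succ)).fderiv]
  simp [dcoord_apply, Finset.sum_add_distrib, Finset.sum_mul]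
  rw [mul_comm, add_mul, add_comm, Finset.sum_mul, Finset.sum_mul]
  congr 1
  · rw [Finset.mul_sum]
    exact Finset.sum_congr rfl fun j _ => by ring

theorem exMetric_eq (u v : Coord (m + 1)) :
    exMetric ε l a b D p u v = inner ℝ (exFrame ε l a b D p u) (exFrame ε l a b D p v) := by
  rw [inner_coord_succ]
  simp only [exFrame_zero, exFrame_succ]
  simp [exMetric, sq, dcoord_apply, mul_add]

theorem exFrame_injective (hp : warp ε l a b (p (Fin.succ 0)) (p 0) ≠ 0) :
    Function.Injective (exFrame ε l a b D p) := by
  refine (injective_iff_map_eq_zero _).2 fun u hu => ?_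
  have h0 : u 0 = 0 := by
    have : exFrame ε l a b D p u 0 = 0 := by rw [hu]; rfl
    rw [exFrame_zero] at this
    exact (mul_eq_zero.1 this).resolve_left hp
  ext i
  refine Fin.cases h0 (fun i => ?_) i
  have : exFrame ε l a b D p u i.succ = 0 := by rw [hu]; rfl
  rw [exFrame_succ, h0] at this
  simpa using this

theorem contDiffOn_exMat (ha : ContDiffOn ℝ ∞ a I) (hb : ContDiffOn ℝ ∞ b I)
    (hD : ∀ i j, ContDiffOn ℝ ∞ (fun w => D w i j) I) :
    ContDiffOn ℝ ∞ (exMat ε l a b D) {p | p 0 ∈ I} :=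
  ((contDiffOn_warp (contDiffOn_warpCoeff ha hb).1 (contDiffOn_warpCoeff ha hb).2 0 _).smul
    contDiffOn_const).add (contDiffOn_tailMap hD)

theorem isCoframeOn_exFrame (hI : IsOpen I) (ha : ContDiffOn ℝ ∞ a I) (hb : ContDiffOn ℝ ∞ b I)
    (hD : ∀ i j, ContDiffOn ℝ ∞ (fun w => D w i j) I)
    (hskew : ∀ w ∈ I, (D w).transpose = -D w) :
    IsCoframeOn (exDomain I ε l a b) (exMetric ε l a b D) (exFrame ε l a b D)
      (exConn ε l a b D) where
  isOpen := isOpen_exDomain hI ha hb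
  smooth := (contDiffOn_exFrame ha hb hD).mono fun _ hp => hp.1
  smooth_conn := contDiffOn_const.smulRight
    ((contDiffOn_exMat ha hb hD).mono fun _ hp => hp.1)
  injective p hp := exFrame_injective hp.2
  metric p _ u v := exMetric_eq u v
  skew p hp u ξ η := by
    simp only [exConn, ContinuousLinearMap.smulRight_apply, smul_apply, real_inner_smul_left,
      real_inner_smul_right, exMat, add_apply, inner_add_left, inner_add_right,
      inner_tailMap (hskew _ hp.1), inner_rot_right]
    ring
  torsion p hp u v := by
    ext i
    simp only [exConn, ContinuousLinearMap.smulRight_apply, smul_apply, dcoord_apply,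
      PiLp.add_apply, PiLp.smul_apply, smul_eq_mul]
    refine Fin.cases ?_ (fun i => ?_) i
    · rw [fderiv_exFrame_zero hI ha hb hD hp.1, fderiv_exFrame_zero hI ha hb hD hp.1, exMat_zero,
        exMat_zero, exFrame_succ, exFrame_succ]
      ring
    · rw [fderiv_exFrame_succ hI ha hb hD hp.1, fderiv_exFrame_succ hI ha hb hD hp.1, exMat_succ,
        exMat_succ, exFrame_zero, exFrame_zero]
      simp only [exFrame_succ, mul_add, Finset.sum_add_distrib, ← mul_assoc, ← Finset.sum_mul]
      split_ifs <;> ring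

theorem connCurv_exConn (hI : IsOpen I) (ha : ContDiffOn ℝ ∞ a I) (hb : ContDiffOn ℝ ∞ b I)
    (hD : ∀ i j, ContDiffOn ℝ ∞ (fun w => D w i j) I) (hp : p 0 ∈ I) (u v : Coord (m + 1)) :
    connCurv (exConn ε l a b D) p u v
      = (-((ε : ℤ) : ℝ) * l ^ 2 * area 0 (Fin.succ 0) (exFrame ε l a b D p u)
          (exFrame ε l a b D p v)) • rot 0 (Fin.succ 0) := by
  obtain ⟨ha1, hb1⟩ := contDiffOn_warpCoeff (ε := ε) (l := l) ha hb
  have hM : HasFDerivAt (exMat ε l a b D) _ p :=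
    ((hasFDerivAt_warp hI ha1 hb1 0 (Fin.succ 0) hp).smul_const
      (rot 0 (Fin.succ 0))).fun_add (hasFDerivAt_tailMap hI hD hp)
  have hΘ (u v : Coord (m + 1)) : fderiv ℝ (exConn ε l a b D) p u v
      = v 0 • fderiv ℝ (exMat ε l a b D) p u := by
    exact fderiv_smulRight hM.differentiableAt (dcoord 0) u v
  rw [connCurv, hΘ, hΘ, hM.fderiv]
  ext1 ξ
  simp only [exConn, area, exFrame_zero, exFrame_succ, warpDeriv_warpCoeff,
    ContinuousLinearMap.smulRight_apply, add_apply, sub_apply,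
    smul_apply, dcoord_apply, smul_eq_mul, ContinuousLinearMap.comp_apply, map_smul]
  module

end Example

end

/-! ### The coframe of `M²(κ) × ℝⁿ⁻²` -/

section

theorem fderiv_smulRight_const {E G : Type*} [NormedAddCommGroup E] [NormedSpace ℝ E]
    [NormedAddCommGroup G] [NormedSpace ℝ G] {φ : E → E →L[ℝ] ℝ} {x : E}
    (hφ : DifferentiableAt ℝ φ x) (c : G) (u v : E) :
    fderiv ℝ (fun y => (φ y).smulRight c) x u v = fderiv ℝ φ x u v • c := by
  have h : HasFDerivAt (fun y => (φ y).smulRight c)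
      ((ContinuousLinearMap.smulRightL ℝ E G).flip c ∘L fderiv ℝ φ x) x :=
    ((ContinuousLinearMap.smulRightL ℝ E G).flip c).hasFDerivAt.comp x hφ.hasFDerivAt
  rw [h.fderiv]; rfl

section Model

variable {m : ℕ} {κ : ℝ} {y : Coord (m + 1)}

/-- The coframe `dy₀ / d`, `dy₁ / d`, `dy₂`, …, `dy_m` of `M²(κ) × ℝⁿ⁻²`, where `d` is the conformal
denominator. -/
noncomputable def modelFrame (κ : ℝ) (y : Coord (m + 1)) : Coord (m + 1) →L[ℝ] Coord (m + 1) :=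
  ∑ i : Fin (m + 1), (if i = 0 ∨ i = 1 then (modelDenom κ y)⁻¹ else 1) •
    (dcoord i).smulRight (EuclideanSpace.single i (1 : ℝ))

/-- The connection form of `M²(κ) × ℝⁿ⁻²`. -/
noncomputable def modelConn (κ : ℝ) (y : Coord (m + 1)) :
    Coord (m + 1) →L[ℝ] Coord (m + 1) →L[ℝ] Coord (m + 1) :=
  ((κ / 2 * (modelDenom κ y)⁻¹) • (y 0 • dcoord 1 - y 1 • dcoord 0)).smulRight (rot 0 1)

theorem modelFrame_apply (u : Coord (m + 1)) (i : Fin (m + 1)) :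
    modelFrame κ y u i = (if i = 0 ∨ i = 1 then (modelDenom κ y)⁻¹ else 1) * u i := by
  simp only [modelFrame, sum_apply, smul_apply, ContinuousLinearMap.smulRight_apply, dcoord_apply,
    WithLp.ofLp_sum, Finset.sum_apply, PiLp.smul_apply, PiLp.single_apply, smul_eq_mul, mul_ite,
    mul_one, mul_zero]
  simp

theorem modelMetric_eq (u v : Coord (m + 1)) :
    modelMetric m κ y u v = inner ℝ (modelFrame κ y u) (modelFrame κ y v) := by
  simp only [PiLp.inner_apply, modelFrame_apply]
  simp only [modelMetric, sq, sum_apply, smul_apply, ContinuousLinearMap.smulRight_apply,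
    dcoord_apply, smul_eq_mul]
  refine Finset.sum_congr rfl fun i _ => ?_
  split_ifs <;> simp <;> ring

theorem contDiff_modelDenom : ContDiff ℝ ∞ (modelDenom (m := m) κ) :=
  contDiff_const.add (contDiff_const.mul
    (((contDiff_coord 0).pow 2).add ((contDiff_coord 1).pow 2)))

theorem isOpen_modelDomain : IsOpen (modelDomain m κ) :=
  isOpen_lt continuous_const contDiff_modelDenom.continuous

theorem contDiffOn_inv_modelDenom :
    ContDiffOn ℝ ∞ (fun y => (modelDenom (m := m) κ y)⁻¹) (modelDomain m κ) :=
  contDiff_modelDenom.contDiffOn.inv fun _ hy => ne_of_gt hy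

theorem hasFDerivAt_inv_modelDenom (hy : y ∈ modelDomain m κ) :
    HasFDerivAt (fun y => (modelDenom (m := m) κ y)⁻¹)
      (-(κ / 2 * ((modelDenom κ y)⁻¹ * (modelDenom κ y)⁻¹)) • (y 0 • dcoord 0 + y 1 • dcoord 1))
      y := by
  have h : HasFDerivAt (modelDenom (m := m) κ) _ y :=
    (((((hasFDerivAt_coord (p := y) 0).pow 2).add
      ((hasFDerivAt_coord (p := y) 1).pow 2)).const_mul (κ / 4)).const_add 1)
  refine ((hasDerivAt_inv (ne_of_gt hy)).comp_hasFDerivAt y h).congr_fderiv ?_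
  ext u
  simp [dcoord_apply]
  ring

theorem contDiffOn_modelFrame : ContDiffOn ℝ ∞ (modelFrame (m := m) κ) (modelDomain m κ) := by
  refine ContDiffOn.sum fun i _ => ContDiffOn.fun_smul ?_ contDiffOn_const
  split_ifs
  · exact contDiffOn_inv_modelDenom
  · exact contDiffOn_const

theorem contDiffOn_modelConn : ContDiffOn ℝ ∞ (modelConn (m := m) κ) (modelDomain m κ) := by
  refine ContDiffOn.smulRight (ContDiffOn.fun_smul (contDiffOn_const.mul contDiffOn_inv_modelDenom)
    ?_) contDiffOn_const
  exact ((contDiff_coord 0).smul contDiff_const).contDiffOn.sub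
    ((contDiff_coord 1).smul contDiff_const).contDiffOn

theorem fderiv_modelFrame (hy : y ∈ modelDomain m κ) (u v : Coord (m + 1)) (i : Fin (m + 1)) :
    fderiv ℝ (modelFrame κ) y u v i = if i = 0 ∨ i = 1 then
      -(κ / 2 * ((modelDenom κ y)⁻¹ * (modelDenom κ y)⁻¹)) * (y 0 * u 0 + y 1 * u 1) * v i
      else 0 := by
  have hd := (contDiffOn_modelFrame.contDiffAt (isOpen_modelDomain.mem_nhds hy)).differentiableAt
    (by simp)
  rw [fderiv_apply_coord hd]
  simp only [modelFrame_apply]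
  split_ifs
  · rw [((hasFDerivAt_inv_modelDenom hy).mul_const (v i)).fderiv]
    simp [dcoord_apply]
    ring
  · simp

theorem isCoframeOn_modelFrame [NeZero m] :
    IsCoframeOn (modelDomain m κ) (modelMetric m κ) (modelFrame κ) (modelConn κ) where
  isOpen := isOpen_modelDomain
  smooth := contDiffOn_modelFrame
  smooth_conn := contDiffOn_modelConn
  injective y hy := by
    refine (injective_iff_map_eq_zero _).2 fun u hu => ?_
    ext i
    have h : modelFrame κ y u i = 0 := by rw [hu]; rfl
    rw [modelFrame_apply] at h
    refine (mul_eq_zero.1 h).resolve_left ?_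
    split_ifs
    · exact inv_ne_zero (ne_of_gt hy)
    · exact one_ne_zero
  metric y _ u v := modelMetric_eq u v
  skew y _ u ξ η := by
    simp only [modelConn, ContinuousLinearMap.smulRight_apply, smul_apply, real_inner_smul_left,
      real_inner_smul_right, inner_rot_right]
    ring
  torsion y hy u v := by
    have h01 : (0 : Fin (m + 1)) ≠ 1 := by simp
    ext i
    simp only [PiLp.add_apply, fderiv_modelFrame hy, modelConn, ContinuousLinearMap.smulRight_apply,
      smul_apply, rot_apply, PiLp.smul_apply, PiLp.sub_apply, PiLp.single_apply, smul_eq_mul,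
      sub_apply, dcoord_apply, modelFrame_apply]
    by_cases h0 : i = 0
    · subst h0; simp [h01]; ring
    · by_cases h1 : i = 1
      · subst h1; simp [h01.symm]; ring
      · simp [h0, h1]

theorem zero_mem_modelDomain : (0 : Coord (m + 1)) ∈ modelDomain m κ := by
  simp [modelDomain, modelDenom]

theorem connCurv_modelConn_zero [NeZero m] (u v : Coord (m + 1)) :
    connCurv (modelConn κ) 0 u v = (κ * area 0 1 (modelFrame κ 0 u) (modelFrame κ 0 v)) •
      (rot 0 1 : Coord (m + 1) →L[ℝ] Coord (m + 1)) := by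
  have h1 : HasFDerivAt (fun y : Coord (m + 1) => y 0 • (dcoord 1 : Coord (m + 1) →L[ℝ] ℝ)
      - y 1 • dcoord 0) _ 0 :=
    ((hasFDerivAt_coord 0).smul_const (dcoord 1)).fun_sub
      ((hasFDerivAt_coord 1).smul_const (dcoord 0))
  have h2 := ((hasFDerivAt_inv_modelDenom (zero_mem_modelDomain (m := m) (κ := κ))).const_mul
    (κ / 2)).fun_smul h1
  have h3 (u v : Coord (m + 1)) : fderiv ℝ (modelConn (m := m) κ) 0 u v
      = (κ / 2 * (u 0 * v 1 - u 1 * v 0)) •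
        (rot 0 1 : Coord (m + 1) →L[ℝ] Coord (m + 1)) := by
    have := fderiv_smulRight_const h2.differentiableAt
      (rot 0 1 : Coord (m + 1) →L[ℝ] Coord (m + 1)) u v
    rw [h2.fderiv] at this
    refine this.trans ?_
    simp [dcoord_apply, modelDenom]
  rw [connCurv, h3, h3]
  ext1 ξ
  simp [modelConn, area, modelFrame_apply, modelDenom]
  module

end Model

end

/-! ### Conformal symmetries and the plane of curvature -/

section

variable {n : ℕ}

section Algebra

variable {a b : Fin n} {G : Coord n →L[ℝ] Coord n}

theorem inner_single_single (i j : Fin n) :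
    inner ℝ (EuclideanSpace.single i (1 : ℝ)) (EuclideanSpace.single j (1 : ℝ))
      = if i = j then (1 : ℝ) else 0 := by
  rw [EuclideanSpace.inner_single_left, PiLp.single_apply]
  simp

theorem area_single {i : Fin n} (hi : i ≠ a) (hi' : i ≠ b) (ξ : Coord n) :
    area a b ξ (EuclideanSpace.single i 1) = 0 ∧ area a b (EuclideanSpace.single i 1) ξ = 0 := by
  simp [area, hi.symm, hi'.symm]

/-- If two multiples of squares of decomposable two-forms differ by a Kulkarni–Nomizu product with
the metric, then the plane of the one and its complement are orthogonal for the other. The two-forms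
are the area form of the coordinates `a`, `b` and its pull-back under `G`. Only the components on
four orthogonal vectors, two of them in the plane, are used; on these the Kulkarni–Nomizu product
vanishes, or can be eliminated. -/
theorem area_eq_zero_of_kulkarniNomizu (hab : a ≠ b) {k c : ℝ} (hk : k ≠ 0)
    {π : Coord n → Coord n}
    (H : ∀ u v ξ η, k * area a b (G u) (G v) * area a b (G ξ) (G η)
      = c * area a b u v * area a b ξ η
        + inner ℝ (wedge v (π u) ξ) η - inner ℝ (wedge u (π v) ξ) η)
    {i j : Fin n} (hij : i ≠ j) (hia : i ≠ a) (hib : i ≠ b) (hja : j ≠ a) (hjb : j ≠ b) :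
    area a b (G (EuclideanSpace.single a 1)) (G (EuclideanSpace.single i 1)) = 0 ∧
    area a b (G (EuclideanSpace.single b 1)) (G (EuclideanSpace.single i 1)) = 0 := by
  set u : Coord n := EuclideanSpace.single a 1 with hu
  set v : Coord n := EuclideanSpace.single b 1 with hv
  set w : Coord n := EuclideanSpace.single i 1 with hw
  set z : Coord n := EuclideanSpace.single j 1 with hz
  have iuv : inner ℝ u v = (0 : ℝ) := by rw [inner_single_single, if_neg hab]
  have iuw : inner ℝ u w = (0 : ℝ) := by rw [inner_single_single, if_neg hia.symm]
  have iuz : inner ℝ u z = (0 : ℝ) := by rw [inner_single_single, if_neg hja.symm]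
  have ivw : inner ℝ v w = (0 : ℝ) := by rw [inner_single_single, if_neg hib.symm]
  have ivz : inner ℝ v z = (0 : ℝ) := by rw [inner_single_single, if_neg hjb.symm]
  have iwz : inner ℝ w z = (0 : ℝ) := by rw [inner_single_single, if_neg hij]
  have ivu := (real_inner_comm u v).trans iuv
  have iwu := (real_inner_comm u w).trans iuw
  have izu := (real_inner_comm u z).trans iuz
  have iwv := (real_inner_comm v w).trans ivw
  have izv := (real_inner_comm v z).trans ivz
  have izw := (real_inner_comm w z).trans iwz
  have iuu : inner ℝ u u = (1 : ℝ) := by rw [inner_single_single, if_pos rfl]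
  have ivv : inner ℝ v v = (1 : ℝ) := by rw [inner_single_single, if_pos rfl]
  have iww : inner ℝ w w = (1 : ℝ) := by rw [inner_single_single, if_pos rfl]
  have izz : inner ℝ z z = (1 : ℝ) := by rw [inner_single_single, if_pos rfl]
  have aw (ξ) : area a b ξ w = 0 := (area_single hia hib ξ).1
  have az (ξ) : area a b ξ z = 0 := (area_single hja hjb ξ).1
  have add_l (x y z : Coord n) : area a b (x + y) z = area a b x z + area a b y z := by
    simp [area]; ring
  have sub_l (x y z : Coord n) : area a b (x - y) z = area a b x z - area a b y z := by
    simp [area]; ring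
  have add_r (x y z : Coord n) : area a b z (x + y) = area a b z x + area a b z y := by
    simp [area]; ring
  have sub_r (x y z : Coord n) : area a b z (x - y) = area a b z x - area a b z y := by
    simp [area]; ring
  -- the components on `u, w, v, z`, on `u, z, v, w`, and after rotations by 45° in either plane
  simp only [wedge_apply, inner_sub_left, real_inner_smul_left] at H
  have h1 := H u w v z
  have h2 := H u z v w
  have h3 := H (u + v) w (v - u) z
  have h4 := H u (w + z) v (z - w)
  -- the sectional components
  have q1 := H u w u w
  have q2 := H v z v z
  have q3 := H u z u z
  have q4 := H v w v w
  simp only [inner_add_left, inner_sub_right, map_add, map_sub,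
    add_l, sub_l, add_r, sub_r, aw, az, iuv, iuw, iuz, ivw, ivz, iwz, ivu, iwu, izu, iwv,
    izv, izw, iuu, ivv, iww, izz] at h1 h2 h3 h4 q1 q2 q3 q4
  generalize area a b (G u) (G w) = x at *
  generalize area a b (G v) (G z) = x' at *
  generalize area a b (G u) (G z) = y at *
  generalize area a b (G v) (G w) = y' at *
  have e1 : x * x' = 0 := mul_left_cancel₀ hk (by linarith)
  have e2 : y * y' = 0 := mul_left_cancel₀ hk (by linarith)
  have e3 : (x + y') * (x' - y) = 0 := mul_left_cancel₀ hk (by linarith)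
  have e4 : (x + y) * (x' - y') = 0 := mul_left_cancel₀ hk (by linarith)
  have e5 : x ^ 2 + x' ^ 2 = y ^ 2 + y' ^ 2 := mul_left_cancel₀ hk (by linarith)
  have hx : x = 0 := by
    by_contra hx
    have hx' : x' = 0 := (mul_eq_zero.1 e1).resolve_left hx
    subst hx'
    have hy : y = 0 := mul_left_cancel₀ hx (by linarith)
    have hy' : y' = 0 := mul_left_cancel₀ hx (by linarith)
    subst hy hy'
    exact hx (by simpa using e5)
  subst hx
  refine ⟨rfl, ?_⟩
  by_contra hy'
  have hy : y = 0 := (mul_eq_zero.1 e2).resolve_right hy'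
  subst hy
  have hx' : x' = 0 := mul_left_cancel₀ hy' (by linarith)
  subst hx'
  exact hy' (by simpa using e5.symm)

/-- A conformal linear map `G` which maps the complement of the plane of the coordinates `a`, `b`
to itself, and this plane to a complement of it, maps the plane to itself. -/
theorem conformal_preserves_plane {c : ℝ} (hc : 0 < c)
    (hG : ∀ ξ η, inner ℝ (G ξ) (G η) = c * inner ℝ ξ η)
    (h0 : ∀ i, i ≠ a → i ≠ b →
      area a b (G (EuclideanSpace.single a 1)) (G (EuclideanSpace.single i 1)) = 0 ∧
      area a b (G (EuclideanSpace.single b 1)) (G (EuclideanSpace.single i 1)) = 0)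
    (hdet : area a b (G (EuclideanSpace.single a 1)) (G (EuclideanSpace.single b 1)) ≠ 0)
    {j : Fin n} (hja : j ≠ a) (hjb : j ≠ b) :
    G (EuclideanSpace.single a 1) j = 0 ∧ G (EuclideanSpace.single b 1) j = 0 := by
  have hab : a ≠ b := by
    rintro rfl
    exact hdet (by simp [area])
  -- `G` maps the complement to itself
  have hcompl (i) (hia : i ≠ a) (hib : i ≠ b) :
      G (EuclideanSpace.single i 1) a = 0 ∧ G (EuclideanSpace.single i 1) b = 0 := by
    obtain ⟨h1, h2⟩ := h0 i hia hib
    simp only [area] at h1 h2 hdet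
    constructor
    · refine mul_left_cancel₀ hdet ?_
      linear_combination (G (EuclideanSpace.single b 1) a) * h1
        - (G (EuclideanSpace.single a 1) a) * h2
    · refine mul_left_cancel₀ hdet ?_
      linear_combination (G (EuclideanSpace.single b 1) b) * h1
        - (G (EuclideanSpace.single a 1) b) * h2
  have hinj : Function.Injective G := by
    refine (injective_iff_map_eq_zero _).2 fun ξ hξ => ?_
    have := hG ξ ξ
    rw [hξ, inner_zero_left] at this
    exact inner_self_eq_zero.1 ((mul_eq_zero.1 this.symm).resolve_left hc.ne')
  obtain ⟨β, hβ⟩ := (LinearMap.injective_iff_surjective (f := (G : Coord n →ₗ[ℝ] Coord n))).1 hinj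
    (EuclideanSpace.single j 1)
  replace hβ : G β = EuclideanSpace.single j 1 := hβ
  have hexp (l) : G β l = ∑ i, β i * G (EuclideanSpace.single i 1) l := by
    have : β = ∑ i : Fin n, β i • EuclideanSpace.single i (1 : ℝ) := by
      ext j; simp [Finset.sum_apply, Pi.single_apply]
    conv_lhs => rw [this]
    simp [map_sum, map_smul, Finset.sum_apply]
  have hexp2 (l) (hl : ∀ i, i ≠ a → i ≠ b → G (EuclideanSpace.single i 1) l = 0) :
      G β l = β a * G (EuclideanSpace.single a 1) l + β b * G (EuclideanSpace.single b 1) l := by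
    rw [hexp, Fintype.sum_eq_add a b hab fun i hi => by rw [hl i hi.1 hi.2, mul_zero]]
  have ea := hexp2 a fun i h1 h2 => (hcompl i h1 h2).1
  have eb := hexp2 b fun i h1 h2 => (hcompl i h1 h2).2
  have za : G β a = 0 := by rw [hβ]; simp [hja.symm]
  have zb : G β b = 0 := by rw [hβ]; simp [hjb.symm]
  rw [za] at ea
  rw [zb] at eb
  simp only [area] at hdet
  have ha : β a = 0 := mul_left_cancel₀ hdet (by
    linear_combination -(G (EuclideanSpace.single b 1) b) * ea
      + (G (EuclideanSpace.single b 1) a) * eb)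
  have hb : β b = 0 := mul_left_cancel₀ hdet (by
    linear_combination (G (EuclideanSpace.single a 1) b) * ea
      - (G (EuclideanSpace.single a 1) a) * eb)
  have f1 := hG (EuclideanSpace.single a 1) β
  have f2 := hG (EuclideanSpace.single b 1) β
  rw [hβ] at f1 f2
  simp [EuclideanSpace.inner_single_right, EuclideanSpace.inner_single_left, ha, hb] at f1 f2
  exact ⟨f1, f2⟩

end Algebra

/-- A metric with product curvature tensor admits a conformal symmetry at `p`, that is, a local
conformal map that fixes `p` and has differential `-id` there, only if the curved planes form a
distribution which is integrable at `p`: in frame components, `[e_a, e_b]` has no component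
orthogonal to the plane. Indeed, this distribution is determined by the Weyl tensor, so the symmetry
preserves it, and the complementary component of the bracket is a tensor of odd rank. -/
theorem IsCoframeOn.conn_eq_of_conformal_symmetry {U W : Set (Coord n)} {g : FormField n}
    {A : Coord n → Coord n →L[ℝ] Coord n} {Θ : Coord n → Coord n →L[ℝ] Coord n →L[ℝ] Coord n}
    (h : IsCoframeOn U g A Θ) (hn : 4 ≤ n) {K : ℝ} (hK : K ≠ 0) {a b : Fin n} (hab : a ≠ b)
    (hcurv : ∀ x ∈ U, ∀ u v, connCurv Θ x u v = (K * area a b (A x u) (A x v)) • rot a b)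
    (hW : IsOpen W) (hWU : W ⊆ U) {s : Coord n → Coord n} (hs : ContDiffOn ℝ ∞ s W)
    (hsU : MapsTo s W U) {τ : Coord n → ℝ} (hτ : ContDiffOn ℝ ∞ τ W)
    (hconf : ∀ x ∈ W, ∀ u v,
      g (s x) (fderiv ℝ s x u) (fderiv ℝ s x v) = Real.exp (2 * τ x) * g x u v)
    {p : Coord n} (hp : p ∈ W) (hsp : s p = p) (hdp : ∀ u, fderiv ℝ s p u = -u)
    {j : Fin n} (hja : j ≠ a) (hjb : j ≠ b) :
    Θ p ((A p).inverse (EuclideanSpace.single a 1)) (EuclideanSpace.single b 1) j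
      = Θ p ((A p).inverse (EuclideanSpace.single b 1)) (EuclideanSpace.single a 1) j := by
  have hinj : ∀ x ∈ W, Function.Injective (fderiv ℝ s x) := fun x hx =>
    (injective_iff_map_eq_zero _).2 fun u hu => by
      by_contra h0
      have h1 := hconf x hx u u
      rw [hu, map_zero] at h1
      exact (mul_pos (Real.exp_pos (2 * τ x)) (h.pos (hWU hx) h0)).ne h1
  set g' : FormField n := fun x => Real.exp (2 * τ x) • g x with hg'
  have hW' := h.mono hW hWU
  have c1 : IsCoframeOn W g' _ _ := h.pullback hW hs hsU hinj fun x hx u v => (hconf x hx u v).symm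
  obtain ⟨t, ht, htτ⟩ := hW'.exists_grad hτ
  have c2 : IsCoframeOn W g' _ _ := hW'.conformal hτ ht htτ fun x _ u v => rfl
  -- the differential of `s`, with values, and then also arguments, in frame components
  let F : Coord n → Coord n →L[ℝ] Coord n := fun x => A (s x) ∘L fderiv ℝ s x
  let G : Coord n → Coord n →L[ℝ] Coord n := fun x => F x ∘L (A x).inverse
  have hGinv (x) (hx : x ∈ W) (u) : G x (A x u) = F x u := by
    simp only [G, ContinuousLinearMap.comp_apply, hW'.inverse_apply hx]
  have key (x) (hx : x ∈ W)
      (hdet : area a b (G x (EuclideanSpace.single a 1)) (G x (EuclideanSpace.single b 1)) ≠ 0) :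
      G x (EuclideanSpace.single a 1) j = 0 ∧ G x (EuclideanSpace.single b 1) j = 0 := by
    obtain ⟨P, hP⟩ := hW'.connCurv_conformal ht hx
    -- compare the curvature of the pulled back and of the conformally changed metric
    have hcmp (u v w z : Coord n) : K * area a b (F x u) (F x v) * area a b (F x w) (F x z)
        = Real.exp (2 * τ x) * (K * area a b (A x u) (A x v) * area a b (A x w) (A x z)
          - (inner ℝ (wedge (A x v) (P u) (A x w)) (A x z)
            - inner ℝ (wedge (A x u) (P v) (A x w)) (A x z))) := by
      have e := (c1.metric x hx (curvatureOp g' x u v w) z).symm.trans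
        (c2.metric x hx (curvatureOp g' x u v w) z)
      rw [c1.apply_curvatureOp hx, c2.apply_curvatureOp hx, h.connCurv_pullback hW hs hsU hx,
        hcurv _ (hsU hx), hP, hcurv _ (hWU hx)] at e
      simp only [smul_apply, add_apply, sub_apply, map_smul, inner_add_left, inner_sub_left,
        real_inner_smul_left, real_inner_smul_right, inner_rot] at e
      rw [two_mul, Real.exp_add]
      simp only [F, ContinuousLinearMap.comp_apply] at e ⊢
      linear_combination -e
    have hF (u v : Coord n) : inner ℝ (F x u) (F x v)
        = Real.exp (2 * τ x) * inner ℝ (A x u) (A x v) := by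
      have e1 := c1.metric x hx u v
      rw [← h.metric x (hWU hx)]
      exact e1.symm
    have hdecomp (ξ : Coord n) : A x ((A x).inverse ξ) = ξ := hW'.apply_inverse hx ξ
    refine conformal_preserves_plane (c := Real.exp (2 * τ x)) (Real.exp_pos _) (fun ξ η => ?_)
      (fun i hia hib => ?_) hdet hja hjb
    · have := hF ((A x).inverse ξ) ((A x).inverse η)
      rwa [hdecomp, hdecomp] at this
    · -- as `n ≥ 4`, there is a fourth coordinate
      obtain ⟨i', hi'⟩ : ∃ i', i' ∉ ({a, b, i} : Finset (Fin n)) := by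
        by_contra! hall
        have h1 := Finset.card_le_card (fun x _ => hall x : (Finset.univ : Finset (Fin n)) ⊆ _)
        have h2 := Finset.card_le_three (a := a) (b := b) (c := i)
        rw [Finset.card_univ, Fintype.card_fin] at h1
        omega
      simp only [Finset.mem_insert, Finset.mem_singleton, not_or] at hi'
      refine area_eq_zero_of_kulkarniNomizu (k := K) (c := Real.exp (2 * τ x) * K)
        (π := fun ξ => -(Real.exp (2 * τ x) • P ((A x).inverse ξ))) hab hK (fun u v ξ η => ?_)
        (Ne.symm hi'.2.2) hia hib hi'.1 hi'.2.1
      have := hcmp ((A x).inverse u) ((A x).inverse v) ((A x).inverse ξ) ((A x).inverse η)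
      simp only [hdecomp] at this
      simp only [G, ContinuousLinearMap.comp_apply, this, map_neg, map_smul, neg_apply, smul_apply,
        inner_neg_left, real_inner_smul_left]
      ring
  -- the differential at `p` is `-id`, so the nondegeneracy assumed in `key` holds near `p`
  have hpU := hWU hp
  have hnhds := hW.mem_nhds hp
  have hpull := fderiv_pullback (C := A) (s := s) (x := p)
    (by rw [hsp]; exact h.differentiableAt hpU) (hs.contDiffAt hnhds)
  have hB : DifferentiableAt ℝ (fun y => (A y).inverse) p :=
    (h.contDiffAt_inverse hpU).differentiableAt (by simp)
  have hFB (ξ : Coord n) := hpull.1.hasFDerivAt.clm_apply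
    (hB.hasFDerivAt.clm_apply (hasFDerivAt_const ξ p))
  have hGp (ξ : Coord n) : G p ξ = -ξ := by
    simp only [G, F, ContinuousLinearMap.comp_apply, hsp, hdp, map_neg, h.apply_inverse hpU]
  have hev : ∀ᶠ x in 𝓝 p,
      area a b (G x (EuclideanSpace.single a 1)) (G x (EuclideanSpace.single b 1)) ≠ 0 := by
    have hc (ξ : Coord n) (i : Fin n) : ContinuousAt (fun x => G x ξ i) p :=
      (contDiff_coord i).continuous.continuousAt.comp (hFB ξ).continuousAt
    refine ContinuousAt.eventually_ne (((hc _ a).mul (hc _ b)).sub ((hc _ b).mul (hc _ a))) ?_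
    simp [hGp, area, hab, hab.symm]
  have hzero : ∀ᶠ x in 𝓝 p,
      G x (EuclideanSpace.single a 1) j = 0 ∧ G x (EuclideanSpace.single b 1) j = 0 := by
    filter_upwards [hev, hnhds] with x h1 h2 using key x h2 h1
  -- differentiate `(G x ξ)_j = 0` at `p`, where `F p = -A p`
  have hder (ξ : Coord n) (hξ : ∀ᶠ x in 𝓝 p, G x ξ j = 0) (v : Coord n) :
      (2 * fderiv ℝ A p v ((A p).inverse ξ) j
        + A p (fderiv ℝ (fderiv ℝ s) p v ((A p).inverse ξ)) j) = 0 := by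
    have h1 := (hasFDerivAt_coord j).comp p (hFB ξ)
    have h2 := h1.unique ((hasFDerivAt_const (0 : ℝ) p).congr_of_eventuallyEq hξ)
    have h3 := congrArg (fun L => L v) h2
    simp only [ContinuousLinearMap.comp_apply, add_apply, ContinuousLinearMap.flip_apply,
      dcoord_apply, PiLp.add_apply, hpull.2, hsp, hdp, map_neg, neg_apply, neg_neg, zero_apply,
      map_zero, zero_add] at h3
    have h4 := ((h.differentiableAt hpU).hasFDerivAt.clm_apply
      (hB.hasFDerivAt.clm_apply (hasFDerivAt_const ξ p))).unique
        ((hasFDerivAt_const ξ p).congr_of_eventuallyEq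
          (by filter_upwards [hnhds] with x hx using hW'.apply_inverse hx ξ))
    have h5 := congrArg (fun L => L v j) h4
    simp only [ContinuousLinearMap.comp_apply, add_apply, ContinuousLinearMap.flip_apply,
      PiLp.add_apply, zero_apply, map_zero, zero_add, PiLp.zero_apply] at h5
    simp only [PiLp.neg_apply] at h3
    linarith
  have ka := hder _ (hzero.mono fun x hx => hx.1) ((A p).inverse (EuclideanSpace.single b 1))
  have kb := hder _ (hzero.mono fun x hx => hx.2) ((A p).inverse (EuclideanSpace.single a 1))
  have tor := congrArg (fun ξ : Coord n => ξ j)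
    (h.torsion p hpU ((A p).inverse (EuclideanSpace.single a 1))
      ((A p).inverse (EuclideanSpace.single b 1)))
  simp only [h.apply_inverse hpU, PiLp.add_apply] at tor
  -- the second derivative of `s` is symmetric and drops out of the difference
  rw [fderiv_fderiv_comm (hs.contDiffAt hnhds)] at ka
  linarith

end

/-! ### Conformal symmetries from symmetries of the target -/

section

variable {n : ℕ} {N : Type*} [TopologicalSpace N] [ChartedSpace (Coord n) N]

/-- The differential of `φ`, with all tangent spaces identified with `ℝⁿ`. -/
noncomputable def diffl (φ : Coord n → N) (x : Coord n) : Coord n →L[ℝ] Coord n :=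
  mfderiv (𝓡 n) (𝓡 n) φ x

/-- A conformal map into a manifold becomes a local diffeomorphism of `ℝⁿ` in any chart. -/
theorem chart_comp_conformal [IsManifold (𝓡 n) ∞ N] {V : Set (Coord n)} (hV : IsOpen V)
    {φ : Coord n → N} (hφ : ContMDiffOn (𝓡 n) (𝓡 n) ∞ φ V)
    (hinj : ∀ x ∈ V, Function.Injective (diffl φ x)) (q : N) :
    ∃ V' : Set (Coord n), V' = V ∩ φ ⁻¹' (extChartAt (𝓡 n) q).source ∧ IsOpen V' ∧
      ContDiffOn ℝ ∞ (extChartAt (𝓡 n) q ∘ φ) V' ∧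
      ∀ x ∈ V', Function.Injective (fderiv ℝ (extChartAt (𝓡 n) q ∘ φ) x) := by
  have hopen : IsOpen (V ∩ φ ⁻¹' (extChartAt (𝓡 n) q).source) :=
    hφ.continuousOn.isOpen_inter_preimage hV (isOpen_extChartAt_source q)
  have hsm : ContDiffOn ℝ ∞ (extChartAt (𝓡 n) q ∘ φ)
      (V ∩ φ ⁻¹' (extChartAt (𝓡 n) q).source) := by
    rw [← contMDiffOn_iff_contDiffOn]
    refine (contMDiffOn_extChartAt (x := q)).comp (hφ.mono inter_subset_left) fun x hx => ?_
    simpa [extChartAt_source] using hx.2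
  refine ⟨_, rfl, hopen, hsm, fun x hx => ?_⟩
  have hψ : MDifferentiableAt (𝓡 n) (𝓡 n) (extChartAt (𝓡 n) q ∘ φ) x :=
    ((hsm.contDiffAt (hopen.mem_nhds hx)).differentiableAt (by simp)).mdifferentiableAt
  have hx' : (extChartAt (𝓡 n) q ∘ φ) x ∈ (extChartAt (𝓡 n) q).target :=
    (extChartAt (𝓡 n) q).map_source hx.2
  have he : MDifferentiableAt (𝓡 n) (𝓡 n) (extChartAt (𝓡 n) q).symm
      ((extChartAt (𝓡 n) q ∘ φ) x) :=
    ((contMDiffOn_extChartAt_symm (n := ∞) q).contMDiffAt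
      ((isOpen_extChartAt_target q).mem_nhds hx')).mdifferentiableAt (by simp)
  have hcomp := mfderiv_comp x he hψ
  have heq : (extChartAt (𝓡 n) q).symm ∘ (extChartAt (𝓡 n) q ∘ φ) =ᶠ[𝓝 x] φ := by
    filter_upwards [hopen.mem_nhds hx] with y hy
    exact (extChartAt (𝓡 n) q).left_inv hy.2
  refine (injective_iff_map_eq_zero _).2 fun u hu => ?_
  refine hinj x hx.1 ?_
  rw [map_zero]
  have h1 : diffl ((extChartAt (𝓡 n) q).symm ∘ (extChartAt (𝓡 n) q ∘ φ)) x u = 0 := by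
    have key (L : Coord n →L[ℝ] Coord n) : L (fderiv ℝ (extChartAt (𝓡 n) q ∘ φ) x u) = 0 := by
      rw [hu, map_zero]
    rw [diffl, hcomp, mfderiv_eq_fderiv]
    exact key _
  have h2 : diffl ((extChartAt (𝓡 n) q).symm ∘ (extChartAt (𝓡 n) q ∘ φ)) x = diffl φ x :=
    heq.mfderiv_eq
  rw [← h2, h1]

/-- If a neighbourhood of `p` is conformally equivalent to an open part of a locally symmetric
space, then the symmetries of the latter induce a conformal symmetry at `p`. -/
theorem exists_conformal_symmetry [IsManifold (𝓡 n) ∞ N] {U : Set (Coord n)} {g : FormField n}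
    (hU : IsOpen U) (hg : ∀ x ∈ U, ∀ u, u ≠ 0 → 0 < g x u u) {p : Coord n} (hp : p ∈ U) {S : Set N}
    {h : TangentForms n N} (hsym : ∀ q ∈ S, ∃ O, IsOpen O ∧ q ∈ O ∧ ∃ s, IsSymmetryAt h q O s)
    (hloc : LocallyConformalAt p g S h) :
    ∃ (W : Set (Coord n)) (s : Coord n → Coord n) (τ : Coord n → ℝ), IsOpen W ∧ p ∈ W ∧ W ⊆ U ∧
      ContDiffOn ℝ ∞ s W ∧ MapsTo s W U ∧ ContDiffOn ℝ ∞ τ W ∧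
      (∀ x ∈ W, ∀ u v,
        g (s x) (fderiv ℝ s x u) (fderiv ℝ s x v) = Real.exp (2 * τ x) * g x u v) ∧
      s p = p ∧ ∀ u, fderiv ℝ s p u = -u := by
  obtain ⟨V₀, hV₀, hpV₀, φ, hφS, hφ₀, σ, hσ₀, hconf₀⟩ := hloc
  obtain ⟨O, hO, hqO, s₀, hs₀, hs₀q, hiso, hds₀⟩ := hsym (φ p) (hφS hpV₀)
  let H : N → Coord n →L[ℝ] Coord n →L[ℝ] ℝ := h
  let E : N → Coord n →L[ℝ] Coord n := fun y => mfderiv (𝓡 n) (𝓡 n) s₀ y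
  set V := V₀ ∩ U with hVdef
  have hV : IsOpen V := hV₀.inter hU
  have hpV : p ∈ V := ⟨hpV₀, hp⟩
  have hφ := hφ₀.mono (inter_subset_left : V ⊆ V₀)
  have hσ := hσ₀.mono (inter_subset_left : V ⊆ V₀)
  have hconf : ∀ x ∈ V, ∀ u v, H (φ x) (diffl φ x u) (diffl φ x v)
      = Real.exp (2 * σ x) * g x u v := fun x hx => hconf₀ x hx.1
  replace hiso : ∀ y ∈ O, ∀ u v, H (s₀ y) (E y u) (E y v) = H y u v := hiso
  replace hds₀ : ∀ u, E (φ p) u = -u := hds₀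
  have hinj : ∀ x ∈ V, Function.Injective (diffl φ x) := fun x hx =>
    (injective_iff_map_eq_zero _).2 fun u hu => by
      by_contra h0
      have h1 := hconf x hx u u
      rw [hu, map_zero] at h1
      exact (mul_pos (Real.exp_pos (2 * σ x)) (hg x hx.2 u h0)).ne h1
  obtain ⟨V', hV'eq, hV', hψ, hψinj⟩ := chart_comp_conformal hV hφ hinj (φ p)
  set e := extChartAt (𝓡 n) (φ p) with he
  set ψ := e ∘ φ with hψdef
  have hmem (x) : x ∈ V' ↔ x ∈ V ∧ φ x ∈ e.source := by rw [hV'eq]; rfl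
  have hpV' : p ∈ V' := (hmem p).2 ⟨hpV, mem_extChartAt_source (φ p)⟩
  have hiso_fderiv (x) (hx : x ∈ V') : ∃ f' : Coord n ≃L[ℝ] Coord n,
      HasFDerivAt ψ (f' : Coord n →L[ℝ] Coord n) x := by
    obtain ⟨f', hf'⟩ := isInvertible_of_injective (hψinj x hx) rfl
    refine ⟨f', ?_⟩
    rw [hf']
    exact ((hψ.contDiffAt (hV'.mem_nhds hx)).differentiableAt (by simp)).hasFDerivAt
  obtain ⟨f', hf'⟩ := hiso_fderiv p hpV'
  have hψp := hψ.contDiffAt (hV'.mem_nhds hpV')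
  set f := hψp.toOpenPartialHomeomorph ψ hf' (by simp) with hfdef
  have hfψ : (f : Coord n → Coord n) = ψ := hψp.toOpenPartialHomeomorph_coe hf' (by simp)
  have hpf : p ∈ f.source := hψp.mem_toOpenPartialHomeomorph_source hf' (by simp)
  -- the points at which `s₀ ∘ φ` is defined and stays in the chart
  set Ω := V' ∩ φ ⁻¹' (O ∩ s₀ ⁻¹' e.source) with hΩdef
  have hΩ : IsOpen Ω := (hφ.continuousOn.mono fun x hx => ((hmem x).1 hx).1).isOpen_inter_preimage
    hV' (hs₀.continuousOn.isOpen_inter_preimage hO (isOpen_extChartAt_source _))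
  set χ : Coord n → Coord n := e ∘ s₀ ∘ φ with hχdef
  have hχ : ContDiffOn ℝ ∞ χ Ω := by
    rw [← contMDiffOn_iff_contDiffOn]
    refine (contMDiffOn_extChartAt (x := φ p)).comp
      (hs₀.comp (hφ.mono fun x hx => ((hmem x).1 hx.1).1) fun x hx => hx.2.1) fun x hx => ?_
    have := hx.2.2
    rwa [he, mem_preimage, extChartAt_source] at this
  have hpΩ : p ∈ Ω := ⟨hpV', hqO, by rw [mem_preimage, hs₀q]; exact mem_extChartAt_source _⟩
  have hχp : χ p = ψ p := by simp only [hχdef, hψdef, Function.comp_apply, hs₀q]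
  have hχt : χ p ∈ f.target := by rw [hχp, ← hfψ]; exact f.map_source hpf
  set s : Coord n → Coord n := f.symm ∘ χ with hsdef
  have hsp : s p = p := by
    rw [hsdef, Function.comp_apply, hχp, ← hfψ]; exact f.left_inv hpf
  set Ω₂ := Ω ∩ χ ⁻¹' f.target with hΩ₂def
  have hΩ₂ : IsOpen Ω₂ := hχ.continuousOn.isOpen_inter_preimage hΩ f.open_target
  have hsΩ₂ : ContinuousOn s Ω₂ := f.continuousOn_symm.comp
    (hχ.continuousOn.mono inter_subset_left) fun x hx => hx.2
  set W := Ω₂ ∩ s ⁻¹' V' with hWdef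
  have hW : IsOpen W := hsΩ₂.isOpen_inter_preimage hΩ₂ hV'
  have hpW : p ∈ W := ⟨⟨hpΩ, hχt⟩, by rw [mem_preimage, hsp]; exact hpV'⟩
  -- smoothness of the inverse of the chart expression of `φ` at all points, not only at `p`
  have hsW : ContDiffOn ℝ ∞ s W := fun x hx => by
    have hx2 : f.symm (χ x) ∈ V' := hx.2
    obtain ⟨f₁, hf₁⟩ := hiso_fderiv _ hx2
    have hsymm : ContDiffAt ℝ ∞ f.symm (χ x) :=
      f.contDiffAt_symm (f₀' := f₁) hx.1.2 (by rw [hfψ]; exact hf₁)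
        (by rw [hfψ]; exact hψ.contDiffAt (hV'.mem_nhds hx2))
    exact (hsymm.comp x (hχ.contDiffAt (hΩ.mem_nhds hx.1.1))).contDiffWithinAt
  have hφs (x) (hx : x ∈ W) : φ (s x) = s₀ (φ x) := by
    have h1 : ψ (s x) = χ x := by rw [← hfψ]; exact f.right_inv hx.1.2
    exact e.injOn ((hmem _).1 hx.2).2 hx.1.1.2.2 h1
  have hd (x) (hx : x ∈ W) (u) : diffl φ (s x) (fderiv ℝ s x u) = E (φ x) (diffl φ x u) := by
    have hVnh (y) (hy : y ∈ V) : MDifferentiableAt (𝓡 n) (𝓡 n) φ y :=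
      (hφ.contMDiffAt (hV.mem_nhds hy)).mdifferentiableAt (by simp)
    have hsx : MDifferentiableAt (𝓡 n) (𝓡 n) s x :=
      ((hsW.contDiffAt (hW.mem_nhds hx)).differentiableAt (by simp)).mdifferentiableAt
    have h1 := mfderiv_comp x (hVnh _ ((hmem _).1 hx.2).1) hsx
    have h2 := mfderiv_comp x ((hs₀.contMDiffAt (hO.mem_nhds hx.1.1.2.1)).mdifferentiableAt
      (by simp)) (hVnh x ((hmem x).1 hx.1.1.1).1)
    have h3 : φ ∘ s =ᶠ[𝓝 x] s₀ ∘ φ := by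
      filter_upwards [hW.mem_nhds hx] with y hy using hφs y hy
    have h4 : diffl (φ ∘ s) x = diffl (s₀ ∘ φ) x := h3.mfderiv_eq
    rw [diffl, diffl, h1, h2, mfderiv_eq_fderiv] at h4
    exact congrArg (fun L : Coord n →L[ℝ] Coord n => L u) h4
  have hWV (x) (hx : x ∈ W) : x ∈ V := ((hmem x).1 hx.1.1.1).1
  have hsV (x) (hx : x ∈ W) : s x ∈ V := ((hmem _).1 hx.2).1
  refine ⟨W, s, fun x => σ x - σ (s x), hW, hpW, fun x hx => (hWV x hx).2, hsW,
    fun x hx => (hsV x hx).2, (hσ.mono hWV).sub (hσ.comp hsW hsV), fun x hx u v => ?_, hsp,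
    fun u => ?_⟩
  · have h1 := hconf (s x) (hsV x hx) (fderiv ℝ s x u) (fderiv ℝ s x v)
    rw [hd x hx, hd x hx, hφs x hx, hiso _ hx.1.1.2.1, hconf x (hWV x hx)] at h1
    rw [mul_sub, Real.exp_sub, div_mul_eq_mul_div, h1,
      mul_div_cancel_left₀ _ (Real.exp_ne_zero _)]
  · have h1 := hd p hpW u
    rw [hsp, hds₀, ← map_neg] at h1
    exact hinj p hpV h1

end

/-! ### The symmetries of `M²(κ) × ℝⁿ⁻²` -/

section

section ModelSymmetry

variable {m : ℕ} {κ : ℝ}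

/-- The projection of `ℝ^{m+1}` to the plane of the first two coordinates, regarded as `ℂ`. -/
noncomputable def toPlane : Coord (m + 1) →L[ℝ] ℂ :=
  (dcoord 0).smulRight 1 + (dcoord 1).smulRight Complex.I

/-- The inclusion of the plane of the first two coordinates. -/
noncomputable def ofPlane : ℂ →L[ℝ] Coord (m + 1) :=
  Complex.reCLM.smulRight (EuclideanSpace.single 0 1)
    + Complex.imCLM.smulRight (EuclideanSpace.single 1 1)

theorem toPlane_re (u : Coord (m + 1)) : (toPlane u).re = u 0 := by simp [toPlane, dcoord_apply]

theorem toPlane_im (u : Coord (m + 1)) : (toPlane u).im = u 1 := by simp [toPlane, dcoord_apply]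

theorem ofPlane_apply [NeZero m] (z : ℂ) (i : Fin (m + 1)) :
    ofPlane z i = if i = 0 then z.re else if i = 1 then z.im else 0 := by
  have h01 : (0 : Fin (m + 1)) ≠ 1 := by simp
  simp only [ofPlane, add_apply, ContinuousLinearMap.smulRight_apply, Complex.reCLM_apply,
    Complex.imCLM_apply, PiLp.add_apply, PiLp.smul_apply, PiLp.single_apply, smul_eq_mul]
  by_cases h0 : i = 0
  · subst h0; simp [h01]
  · simp [h0]

theorem modelMetric_apply [NeZero m] (y u v : Coord (m + 1)) :
    modelMetric m κ y u v = (modelDenom κ y ^ 2)⁻¹ * (u 0 * v 0 + u 1 * v 1)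
      + ∑ i : Fin (m + 1), if i = 0 ∨ i = 1 then 0 else u i * v i := by
  have h01 : (0 : Fin (m + 1)) ≠ 1 := by simp
  have h2 : u 0 * v 0 + u 1 * v 1
      = ∑ i : Fin (m + 1), if i = 0 ∨ i = 1 then u i * v i else 0 := by
    rw [Fintype.sum_eq_add 0 1 h01 fun i hi => if_neg (by tauto)]
    simp
  rw [h2, Finset.mul_sum, ← Finset.sum_add_distrib]
  simp only [modelMetric, sq, sum_apply, smul_apply, ContinuousLinearMap.smulRight_apply,
    dcoord_apply, smul_eq_mul]
  refine Finset.sum_congr rfl fun i _ => ?_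
  split_ifs <;> simp

theorem modelDenom_eq (y : Coord (m + 1)) :
    modelDenom κ y = 1 + κ / 4 * Complex.normSq (toPlane y) := by
  rw [modelDenom, Complex.normSq_apply, toPlane_re, toPlane_im]; ring

/-- The rotation by `π` about the point `a` of the surface of curvature `4 k`, in the stereographic
chart. -/
noncomputable def planeSymm (k : ℝ) (a z : ℂ) : ℂ :=
  (2 * a - (1 - k * Complex.normSq a : ℝ) * z)
    * ((1 - k * Complex.normSq a : ℝ) + 2 * k * (starRingEnd ℂ a) * z)⁻¹

theorem hasDerivAt_planeSymm {k : ℝ} {a z : ℂ}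
    (h : ((1 - k * Complex.normSq a : ℝ) : ℂ) + 2 * k * (starRingEnd ℂ a) * z ≠ 0) :
    HasDerivAt (planeSymm k a) (-((1 + k * Complex.normSq a : ℝ) ^ 2
      * (((1 - k * Complex.normSq a : ℝ) + 2 * k * (starRingEnd ℂ a) * z)⁻¹) ^ 2)) z := by
  have h1 : HasDerivAt (fun z => 2 * a - ((1 - k * Complex.normSq a : ℝ) : ℂ) * z) _ z :=
    ((hasDerivAt_id z).const_mul ((1 - k * Complex.normSq a : ℝ) : ℂ)).const_sub (2 * a)
  have h2 : HasDerivAt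
      (fun z => ((1 - k * Complex.normSq a : ℝ) : ℂ) + 2 * k * (starRingEnd ℂ a) * z) _ z :=
    ((hasDerivAt_id z).const_mul (2 * k * (starRingEnd ℂ a))).const_add
      ((1 - k * Complex.normSq a : ℝ) : ℂ)
  refine (h1.mul (h2.inv h)).congr_deriv ?_
  have h3 : (starRingEnd ℂ a) * a = (Complex.normSq a : ℂ) := Complex.normSq_eq_conj_mul_self.symm
  simp only [Pi.inv_apply]
  field_simp
  push_cast
  linear_combination (-4 * k : ℂ) * h3

theorem planeSymm_self {k : ℝ} {a : ℂ} (h : 1 + k * Complex.normSq a ≠ 0) :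
    planeSymm k a a = a := by
  have h3 : (starRingEnd ℂ a) * a = (Complex.normSq a : ℂ) := Complex.normSq_eq_conj_mul_self.symm
  have h4 : ((1 - k * Complex.normSq a : ℝ) : ℂ) + 2 * k * (starRingEnd ℂ a) * a
      = ((1 + k * Complex.normSq a : ℝ) : ℂ) := by
    push_cast; linear_combination (2 * k : ℂ) * h3
  have h5 : ((1 + k * Complex.normSq a : ℝ) : ℂ) ≠ 0 := by exact_mod_cast h
  rw [planeSymm, h4]
  field_simp
  push_cast
  ring

/-- The stereographic factor of the image of a point under a half-turn. -/
theorem one_add_normSq_planeSymm {k : ℝ} {a z : ℂ}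
    (h : ((1 - k * Complex.normSq a : ℝ) : ℂ) + 2 * k * (starRingEnd ℂ a) * z ≠ 0) :
    1 + k * Complex.normSq (planeSymm k a z) = (1 + k * Complex.normSq a) ^ 2
      * (1 + k * Complex.normSq z)
      * (Complex.normSq ((1 - k * Complex.normSq a : ℝ) + 2 * k * (starRingEnd ℂ a) * z))⁻¹ := by
  have h0 := mt Complex.normSq_eq_zero.1 h
  rw [planeSymm, map_mul, map_inv₀, eq_mul_inv_iff_mul_eq₀ h0, add_mul, ← mul_assoc k,
    inv_mul_cancel_right₀ h0]
  simp only [Complex.normSq_apply]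
  simp
  ring

/-- The symmetry of `M²(κ) × ℝⁿ⁻²` at the point `q`: a half-turn of the surface, times a reflection
of the flat factor. -/
noncomputable def modelSymm (κ : ℝ) (q y : Coord (m + 1)) : Coord (m + 1) :=
  ofPlane (planeSymm (κ / 4) (toPlane q) (toPlane y))
    + ((2 : ℝ) • q - y - ofPlane (toPlane ((2 : ℝ) • q - y)))

theorem exists_isSymmetryAt_model [NeZero m] {q : Coord (m + 1)} (hq : q ∈ modelDomain m κ) :
    ∃ O, IsOpen O ∧ q ∈ O ∧ ∃ s : Coord (m + 1) → Coord (m + 1),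
      IsSymmetryAt (n := m + 1) (fun x => modelMetric m κ x) q O s := by
  set k := κ / 4 with hk
  set a : ℂ := toPlane q with ha
  set γ : Coord (m + 1) → ℂ := fun y =>
    ((1 - k * Complex.normSq a : ℝ) : ℂ) + 2 * k * (starRingEnd ℂ a) * toPlane y with hγ
  have hq' : 1 + k * Complex.normSq a ≠ 0 := by
    rw [ha, hk, ← modelDenom_eq]; exact ne_of_gt hq
  have hγc : ContDiff ℝ ∞ γ := contDiff_const.add (contDiff_const.mul toPlane.contDiff)
  have h3 : (starRingEnd ℂ a) * a = (Complex.normSq a : ℂ) := Complex.normSq_eq_conj_mul_self.symm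
  have hγq : γ q = ((1 + k * Complex.normSq a : ℝ) : ℂ) := by
    simp only [hγ, ← ha]; push_cast; linear_combination (2 * k : ℂ) * h3
  have h5 : ((1 + k * Complex.normSq a : ℝ) : ℂ) ≠ 0 := by exact_mod_cast hq'
  have hd (y) (hy : γ y ≠ 0) : HasFDerivAt (modelSymm κ q)
      (ofPlane ∘L ((-((1 + k * Complex.normSq a : ℝ) ^ 2 * ((γ y)⁻¹) ^ 2) : ℂ) • toPlane)
        + (-ContinuousLinearMap.id ℝ _ + ofPlane ∘L toPlane)) y := by
    have h1 : HasFDerivAt (fun y => planeSymm k a (toPlane y)) _ y :=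
      ((hasDerivAt_planeSymm (k := k) (a := a) hy).hasFDerivAt.restrictScalars ℝ).comp y
        (toPlane (m := m)).hasFDerivAt
    have h2 : HasFDerivAt (fun y => ofPlane (m := m) (planeSymm k a (toPlane y))) _ y :=
      ofPlane.hasFDerivAt.comp y h1
    have h3 : HasFDerivAt (fun y : Coord (m + 1) => (2 : ℝ) • q - y) _ y :=
      (hasFDerivAt_id (𝕜 := ℝ) y).const_sub ((2 : ℝ) • q)
    have h4 : HasFDerivAt
        (fun y : Coord (m + 1) => ofPlane (m := m) (toPlane ((2 : ℝ) • q - y))) _ y :=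
      ofPlane.hasFDerivAt.comp y ((toPlane (m := m)).hasFDerivAt.comp y h3)
    refine (h2.add (h3.sub h4)).congr_fderiv ?_
    ext1 u
    simp [γ, mul_comm]
  have hcoord (y) (hy : γ y ≠ 0) (u : Coord (m + 1)) (i : Fin (m + 1)) :
      fderiv ℝ (modelSymm κ q) y u i =
        if i = 0 then (-((1 + k * Complex.normSq a : ℝ) ^ 2 * ((γ y)⁻¹) ^ 2) * toPlane u : ℂ).re
        else if i = 1 then
          (-((1 + k * Complex.normSq a : ℝ) ^ 2 * ((γ y)⁻¹) ^ 2) * toPlane u : ℂ).im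
        else -u i := by
    rw [(hd y hy).fderiv]
    simp only [add_apply, ContinuousLinearMap.comp_apply, smul_apply, neg_apply,
      ContinuousLinearMap.id_apply, PiLp.add_apply, PiLp.neg_apply, ofPlane_apply, toPlane_re,
      toPlane_im, smul_eq_mul]
    split_ifs with h1 h2
    · subst h1; ring
    · subst h2; ring
    · ring
  have hsy (y : Coord (m + 1)) : toPlane (modelSymm κ q y) = planeSymm k a (toPlane y) := by
    apply Complex.ext
    · simp [toPlane_re, modelSymm, ofPlane_apply, ← hk, ← ha]
    · simp [toPlane_im, modelSymm, ofPlane_apply, ← hk, ← ha]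
  have hisom (y) (hy : γ y ≠ 0) (u v : Coord (m + 1)) :
      modelMetric m κ (modelSymm κ q y) (fderiv ℝ (modelSymm κ q) y u)
        (fderiv ℝ (modelSymm κ q) y v) = modelMetric m κ y u v := by
    have h0 := mt Complex.normSq_eq_zero.1 hy
    have key (u v : Coord (m + 1)) (c : ℂ) : (c * toPlane u).re * (c * toPlane v).re
        + (c * toPlane u).im * (c * toPlane v).im
        = Complex.normSq c * (u 0 * v 0 + u 1 * v 1) := by
      simp only [Complex.mul_re, Complex.mul_im, toPlane_re, toPlane_im, Complex.normSq_apply]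
      ring
    have h01 : (1 : Fin (m + 1)) ≠ 0 := by simp
    rw [modelMetric_apply, modelMetric_apply]
    congr 1
    · rw [hcoord y hy, hcoord y hy, hcoord y hy, hcoord y hy, if_pos rfl, if_pos rfl, if_neg h01,
        if_neg h01, if_pos rfl, if_pos rfl, key, modelDenom_eq, hsy, one_add_normSq_planeSymm hy,
        modelDenom_eq, ← hk]
      simp only [Complex.normSq_neg, map_mul, map_pow, map_inv₀, Complex.normSq_ofReal]
      change _ * (_ * (Complex.normSq (γ y))⁻¹ ^ 2 * _) = _
      generalize u 0 * v 0 + u 1 * v 1 = X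
      have h9 : Complex.normSq (((1 - k * Complex.normSq a : ℝ) : ℂ)
        + 2 * k * (starRingEnd ℂ a) * toPlane y) ≠ 0 := h0
      simp only [hγ]
      generalize Complex.normSq (((1 - k * Complex.normSq a : ℝ) : ℂ)
        + 2 * k * (starRingEnd ℂ a) * toPlane y) = Γ at h9 ⊢
      generalize 1 + k * Complex.normSq a = d at hq' ⊢
      simp only [mul_pow, mul_inv, inv_pow, inv_inv]
      field_simp
    · refine Finset.sum_congr rfl fun i _ => ?_
      split_ifs with hi
      · rfl
      · rw [not_or] at hi
        rw [hcoord y hy, hcoord y hy, if_neg hi.1, if_neg hi.2, if_neg hi.1, if_neg hi.2]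
        ring
  refine ⟨γ ⁻¹' {0}ᶜ, isOpen_compl_singleton.preimage hγc.continuous, ?_, modelSymm κ q, ?_, ?_,
    ?_, ?_⟩
  · rw [mem_preimage, hγq]; exact h5
  · rw [contMDiffOn_iff_contDiffOn]
    refine ContDiffOn.add (ofPlane.contDiff.comp_contDiffOn (ContDiffOn.mul ?_ ?_)) ?_
    · exact (contDiff_const.sub (contDiff_const.mul toPlane.contDiff)).contDiffOn
    · exact ContDiffOn.inv hγc.contDiffOn fun y hy => hy
    · exact ((contDiff_const.sub contDiff_id).sub (ofPlane.contDiff.comp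
        (toPlane.contDiff.comp (contDiff_const.sub contDiff_id)))).contDiffOn
  · ext i
    have h6 : (2 : ℝ) • q - q = q := by module
    have h7 := planeSymm_self (k := k) (a := a) hq'
    rw [modelSymm, h6, ← hk, ← ha, h7]
    simp
  · intro y hy u v
    rw [mfderiv_eq_fderiv]
    exact hisom y hy u v
  · intro u
    rw [mfderiv_eq_fderiv]
    have hq0 : γ q ≠ 0 := by rw [hγq]; exact h5
    have : fderiv ℝ (modelSymm κ q) q u = -u := by
      ext i
      rw [hcoord q hq0, hγq]
      have h8 : (-(((1 + k * Complex.normSq a : ℝ) : ℂ) ^ 2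
          * (((1 + k * Complex.normSq a : ℝ) : ℂ)⁻¹) ^ 2)) = -1 := by
        field_simp
      rw [h8]
      split_ifs with h1 h2
      · subst h1; simp [toPlane_re]
      · subst h2; simp [toPlane_im]
      · rfl
    exact this

end ModelSymmetry

end

/-! ### Conclusion -/

section

variable {m : ℕ} [NeZero m] {ε : ℤˣ} {l : ℝ} {a b : ℝ → ℝ} {D : ℝ → Matrix (Fin m) (Fin m) ℝ}
  {I : Set ℝ}

theorem neg_units_mul_sq_ne_zero (ε : ℤˣ) (hl : 0 < l) : -((ε : ℤ) : ℝ) * l ^ 2 ≠ 0 := by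
  have : ((ε : ℤ) : ℝ) ≠ 0 := by exact_mod_cast ε.ne_zero
  exact mul_ne_zero (neg_ne_zero.2 this) (pow_ne_zero 2 hl.ne')

theorem exists_warp_ne_zero (hl : 0 < l) {w : ℝ} (ha : a w ≠ 0) : ∃ x, warp ε l a b x w ≠ 0 := by
  rcases Int.units_eq_one_or ε with rfl | rfl
  · by_contra! h
    have h0 := h 0
    have h1 := h 1
    simp only [warp, if_true, mul_zero, Real.exp_zero, neg_zero, mul_one] at h0 h1
    have hlt : Real.exp (-l) < Real.exp l := Real.exp_lt_exp.2 (by linarith)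
    have : a w * (Real.exp l - Real.exp (-l)) = 0 := by
      linear_combination h1 - Real.exp (-l) * h0
    exact (mul_ne_zero ha (sub_pos.2 hlt).ne') this
  · have h1 : ¬ ((-1 : ℤˣ) = 1) := by decide
    exact ⟨0, by simpa [warp, h1] using ha⟩

theorem hasProductCurvature_exMetric (hI : IsOpen I) (ha : ContDiffOn ℝ ∞ a I)
    (hb : ContDiffOn ℝ ∞ b I) (hD : ∀ i j, ContDiffOn ℝ ∞ (fun w => D w i j) I)
    (hskew : ∀ w ∈ I, (D w).transpose = -D w) {p : Coord (m + 1)}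
    (hp : p ∈ exDomain I ε l a b) :
    HasProductCurvature (-((ε : ℤ) : ℝ) * l ^ 2) 0 (Fin.succ 0) (exMetric ε l a b D) p :=
  (isCoframeOn_exFrame hI ha hb hD hskew).hasProductCurvature hp
    (connCurv_exConn hI ha hb hD hp.1)

theorem hasProductCurvature_modelMetric (κ : ℝ) :
    HasProductCurvature κ 0 (Fin.succ 0) (modelMetric m κ) 0 := by
  have h1 : (Fin.succ 0 : Fin (m + 1)) = 1 := by simp
  rw [h1]
  exact isCoframeOn_modelFrame.hasProductCurvature zero_mem_modelDomain connCurv_modelConn_zero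

/-- The `i`-th component of the bracket `[e₀, e₁]` of the first two vectors of the frame is
`D_i1 / f`. Where it does not vanish, the curved planes are not integrable, which excludes conformal
symmetries. -/
theorem not_locallyConformalAt_exMetric (hm : 3 ≤ m) (hI : IsOpen I) (hl : 0 < l)
    (ha : ContDiffOn ℝ ∞ a I) (hb : ContDiffOn ℝ ∞ b I)
    (hD : ∀ i j, ContDiffOn ℝ ∞ (fun w => D w i j) I)
    (hskew : ∀ w ∈ I, (D w).transpose = -D w) {p : Coord (m + 1)}
    (hp : p ∈ exDomain I ε l a b) {i : Fin m} (hi : i ≠ 0) (hDi : D (p 0) 0 i ≠ 0)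
    {N : Type*} [TopologicalSpace N] [ChartedSpace (Coord (m + 1)) N]
    [IsManifold (𝓡 (m + 1)) ∞ N] {S : Set N} {h : TangentForms (m + 1) N}
    (hsym : ∀ q ∈ S, ∃ O, IsOpen O ∧ q ∈ O ∧ ∃ s, IsSymmetryAt h q O s) :
    ¬ LocallyConformalAt p (exMetric ε l a b D) S h := by
  intro hloc
  have hA := isCoframeOn_exFrame (ε := ε) (l := l) hI ha hb hD hskew
  obtain ⟨W, s, τ, hW, hpW, hWU, hs, hsU, hτ, hconf, hsp, hds⟩ :=
    exists_conformal_symmetry hA.isOpen (fun x hx u hu => hA.pos hx hu) hp hsym hloc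
  have h0b : (0 : Fin (m + 1)) ≠ Fin.succ 0 := (Fin.succ_ne_zero 0).symm
  have key := hA.conn_eq_of_conformal_symmetry (by omega) (neg_units_mul_sq_ne_zero ε hl) h0b
    (fun x hx => connCurv_exConn hI ha hb hD hx.1) hW hWU hs hsU hτ hconf hpW hsp hds
    (j := i.succ) (Fin.succ_ne_zero i) (fun h => hi (Fin.succ_inj.1 h))
  have e0 := congrArg (fun ξ : Coord (m + 1) => ξ 0)
    (hA.apply_inverse hp (EuclideanSpace.single 0 1))
  have e1 := congrArg (fun ξ : Coord (m + 1) => ξ 0)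
    (hA.apply_inverse hp (EuclideanSpace.single (Fin.succ 0) 1))
  simp only [exFrame_zero, PiLp.single_apply, if_true, if_neg h0b] at e0 e1
  have hv1 := (mul_eq_zero.1 e1).resolve_left hp.2
  have hv0 := right_ne_zero_of_mul (e0.trans_ne one_ne_zero)
  have hDi' : D (p 0) i 0 ≠ 0 := by
    have := congrFun (congrFun (hskew _ hp.1) i) 0
    rw [Matrix.transpose_apply, Matrix.neg_apply] at this
    rw [this] at hDi
    exact neg_ne_zero.1 hDi
  simp only [exConn, ContinuousLinearMap.smulRight_apply, smul_apply, PiLp.smul_apply, dcoord_apply,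
    hv1, zero_smul, exMat_succ, if_neg hi, PiLp.single_apply, Fin.succ_inj, zero_add, mul_ite,
    mul_one, mul_zero, Finset.sum_ite_eq', Finset.mem_univ, if_true, smul_eq_mul] at key
  exact mul_ne_zero hv0 hDi' key

theorem notConformal_exMetric (hm : 3 ≤ m) (hI : IsOpen I) (hl : 0 < l)
    (ha : ContDiffOn ℝ ∞ a I) (hb : ContDiffOn ℝ ∞ b I)
    (hD : ∀ i j, ContDiffOn ℝ ∞ (fun w => D w i j) I)
    (hskew : ∀ w ∈ I, (D w).transpose = -D w) {p : Coord (m + 1)}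
    (hp : p ∈ exDomain I ε l a b) {i : Fin m} (hi : i ≠ 0) (hDi : D (p 0) 0 i ≠ 0) (κ : ℝ) :
    NotConformallySymmetricAt.{u} p (exMetric ε l a b D) ∧
      NotConformalToModelAt κ p (exMetric ε l a b D) := by
  refine ⟨fun N _ _ _ h hsym => ?_, ?_⟩
  · exact not_locallyConformalAt_exMetric hm hI hl ha hb hD hskew hp hi hDi fun q _ => hsym q
  · exact not_locallyConformalAt_exMetric hm hI hl ha hb hD hskew hp hi hDi fun q hq =>
      exists_isSymmetryAt_model hq

theorem exists_units_mul_sq {κ : ℝ} (hκ : κ ≠ 0) :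
    ∃ (ε : ℤˣ) (l : ℝ), 0 < l ∧ κ = -((ε : ℤ) : ℝ) * l ^ 2 := by
  rcases lt_or_gt_of_ne hκ with h | h
  · exact ⟨1, √(-κ), Real.sqrt_pos.2 (by linarith), by simp [Real.sq_sqrt (neg_pos.2 h).le]⟩
  · exact ⟨-1, √κ, Real.sqrt_pos.2 h, by simp [Real.sq_sqrt h.le]⟩

/-- The infinitesimal rotation in the plane of two distinct coordinates, as a matrix. -/
def rotMatrix (i j : Fin m) : Matrix (Fin m) (Fin m) ℝ :=
  Matrix.single i j 1 - Matrix.single j i 1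

end

end WeylHom

open WeylHom

theorem mainTheorem3 (m : ℕ) [NeZero m] (hm : 3 ≤ m) :
    -- the metrics `ds²`, on manifolds of dimension `n = m + 1 ≥ 4`
    (∀ (I : Set ℝ) (ε : ℤˣ) (l : ℝ) (a b : ℝ → ℝ) (D : ℝ → Matrix (Fin m) (Fin m) ℝ) (κ : ℝ),
      IsOpen I → I.OrdConnected → (0 : ℝ) ∈ I → 0 < l →
      ContDiffOn ℝ ∞ a I → (∀ w ∈ I, a w ≠ 0) →
      ContDiffOn ℝ ∞ b I → (∀ w ∈ I, b w ≠ 0) →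
      (∀ i j, ContDiffOn ℝ ∞ (fun w => D w i j) I) → (∀ w ∈ I, (D w).transpose = -D w) →
      κ = -((ε : ℤ) : ℝ) * l ^ 2 →
      IsRiemannianMetricOn (exDomain I ε l a b) (exMetric ε l a b D) ∧
      CurvatureHomogeneous (exDomain I ε l a b) (exMetric ε l a b D) ∧
      CurvatureModeledOn (exDomain I ε l a b) (exMetric ε l a b D) (modelMetric m κ) 0 ∧
      WeylHomogeneous (exDomain I ε l a b) (exMetric ε l a b D) ∧
      WeylModeledOn (exDomain I ε l a b) (exMetric ε l a b D) (modelMetric m κ) 0 ∧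
      -- wherever some `D_1i(w)` with `i > 1` does not vanish, `ds²` is not even locally
      -- conformally equivalent to a symmetric space, nor to the model space
      ∀ w ∈ I, (∃ i : Fin m, i ≠ 0 ∧ D w 0 i ≠ 0) →
        (∃ p ∈ exDomain (m := m) I ε l a b, p 0 = w) ∧
        ∀ p ∈ exDomain (m := m) I ε l a b, p 0 = w →
          NotConformallySymmetricAt.{u} p (exMetric ε l a b D) ∧
          NotConformalToModelAt κ p (exMetric ε l a b D)) ∧
    -- hence the reducible model spaces `M²(κ) × ℝⁿ⁻²`, `κ ≠ 0`, do not determine the local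
    -- conformal class
    (∀ κ : ℝ, κ ≠ 0 → ∃ (U : Set (Coord (m + 1))) (g : FormField (m + 1)),
      IsConnected U ∧ IsRiemannianMetricOn U g ∧
      WeylHomogeneous U g ∧ WeylModeledOn U g (modelMetric m κ) 0 ∧
      ∀ p ∈ U, NotConformallySymmetricAt.{u} p g ∧ NotConformalToModelAt κ p g) := by
  refine ⟨?_, ?_⟩
  · rintro I ε l a b D κ hI - - hl ha ha0 hb - hD hskew rfl
    have hex {p} (hp : p ∈ exDomain I ε l a b) :=
      hasProductCurvature_exMetric hI ha hb hD hskew hp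
    have hmod := hasProductCurvature_modelMetric (m := m) (-((ε : ℤ) : ℝ) * l ^ 2)
    refine ⟨(isCoframeOn_exFrame hI ha hb hD hskew).isRiemannianMetricOn,
      fun x hx y hy => (hex hx).sameCurvature (hex hy), fun x hx => (hex hx).sameCurvature hmod,
      fun x hx y hy => (hex hx).sameWeyl (hex hy), fun x hx => (hex hx).sameWeyl hmod, ?_⟩
    rintro w hw ⟨i, hi, hDi⟩
    refine ⟨?_, fun p hp hpw => ?_⟩
    · obtain ⟨x, hx⟩ := exists_warp_ne_zero (ε := ε) (b := b) hl (ha0 w hw)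
      refine ⟨EuclideanSpace.single 0 w + EuclideanSpace.single (Fin.succ 0) x, ?_, ?_⟩
      · refine ⟨?_, ?_⟩ <;> simpa [PiLp.single_apply]
      · simp
    · subst hpw
      exact notConformal_exMetric hm hI hl ha hb hD hskew hp hi hDi _
  · intro κ hκ
    obtain ⟨ε, l, hl, rfl⟩ := exists_units_mul_sq hκ
    -- the metric with constant `a = b = 1` and `D`, near the hyperplane `x₁ = 0`
    let i₁ : Fin m := ⟨1, by omega⟩
    have hi₁ : i₁ ≠ 0 := by
      intro h
      have := congrArg Fin.val h
      simp [i₁] at this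
    let D : ℝ → Matrix (Fin m) (Fin m) ℝ := fun _ => rotMatrix 0 i₁
    have hD : ∀ i j, ContDiffOn ℝ ∞ (fun w => D w i j) univ := fun i j => contDiffOn_const
    have hskew : ∀ w ∈ (univ : Set ℝ), (D w).transpose = -D w := fun w _ => by
      simp [D, rotMatrix]
    have h1 : ContDiffOn ℝ ∞ (fun _ : ℝ => (1 : ℝ)) univ := contDiffOn_const
    have hf : Continuous fun x => warp ε l (fun _ => 1) (fun _ => 1) x 0 :=
      (contDiff_warp_const ε l 1 1 0).continuous
    have hf0 : warp ε l (fun _ => 1) (fun _ => 1) 0 0 ≠ 0 := by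
      unfold warp; split_ifs <;> norm_num
    obtain ⟨r, hr, hball⟩ := Metric.eventually_nhds_iff_ball.1 (hf.continuousAt.eventually_ne hf0)
    let U : Set (Coord (m + 1)) := (dcoord (Fin.succ 0)) ⁻¹' Metric.ball 0 r
    have hUo : IsOpen U := Metric.isOpen_ball.preimage (dcoord (Fin.succ 0)).continuous
    have hU : U ⊆ exDomain univ ε l (fun _ => 1) (fun _ => 1) := fun p hp =>
      ⟨mem_univ _, hball _ hp⟩
    have hex {p} (hp : p ∈ U) := hasProductCurvature_exMetric isOpen_univ h1 h1 hD hskew (hU hp)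
    refine ⟨U, exMetric ε l (fun _ => 1) (fun _ => 1) D, ⟨⟨0, by simp [U, hr]⟩, ?_⟩,
      ((isCoframeOn_exFrame isOpen_univ h1 h1 hD hskew).mono hUo hU).isRiemannianMetricOn,
      fun x hx y hy => (hex hx).sameWeyl (hex hy),
      fun x hx => (hex hx).sameWeyl (hasProductCurvature_modelMetric _), fun p hp => ?_⟩
    · exact ((convex_ball (0 : ℝ) r).is_linear_preimage
        (dcoord (Fin.succ 0)).toLinearMap.isLinear).isPreconnected
    · refine notConformal_exMetric hm isOpen_univ hl h1 h1 hD hskew (hU hp) hi₁ ?_ _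
      simp [D, rotMatrix, hi₁]
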